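/- Fix a base $b\ge 2$ and let $A_b=\{0,1,\dots,b-1\}$. It is decidable in linear time whether a minimal DFA over $A_b$ satisfies the UP-criterion. Precisely: there are a program for a random access machine (with registers and arrays, whose arithmetic is unit-cost addition and truncated subtraction) and a constant $C$, both depending on $b$ only, such that, given the number of states, the initial state, the final states and the transition table of any complete minimal DFA with states $0,\dots,n-1$, the program halts within $Cn$ steps, using only numbers smaller than $Cn$, and outputs $1$ if the DFA satisfies the UP-criterion and $0$ otherwise. Here a complete DFA $\mathcal A$ is minimal if all its states are reachable from the initial state and distinct states accept distinct languages. The condensation of $\mathcal A$ is the directed graph on its strongly connected components (SCCs), with an edge from $X$ to $Y$ whenever some transition leads from a state of $X$ to a state of $Y$; loops are disregarded when speaking of successors and leaves. An SCC is non-trivial if it contains an internal transition, of Type 1 if it contains an internal transition labelled by a digit different from $0$, and of Type 2 if it is non-trivial and not of Type 1. For $p\ge1$ coprime to $b$ and $R\subseteq\mathbb Z/p\mathbb Z$ such that $p$ is the smallest period of $\{m\in\mathbb N : m \bmod p\in R\}$, let $\psi\ge 1$ be least with $b^\psi\equiv1 \pmod p$; the Pascal automaton $\mathcal P_p^R$ has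 state set $\mathbb Z/p\mathbb Z\times\mathbb Z/\psi\mathbb Z$, initial state $(0,0)$, set of final states $R\times\mathbb Z/\psi\mathbb Z$, and transitions $(s,t)\cdot a=(s+ab^t,\,t+1)$. The DFA $\mathcal A$ satisfies the UP-criterion if the following conditions hold. * (UP-0) The successor by $0$ of a state is final if and only if that state is final. * (UP-1) Every Type 1 SCC is a leaf of the condensation. * (UP-2) Every Type 2 SCC is a simple circuit labelled by $0$ and has a unique successor in the condensation, which is a leaf. * (UP-3) Every Type 1 SCC is, for a suitable choice of initial state in it, a quotient of some Pascal automaton $\mathcal P_p^R$, that is, the image of $\mathcal P_p^R$ under a map that commutes with the transitions, and preserves and reflects finality. * (UP-4) Every Type 2 SCC $X$ is embeddable in its unique successor $Y$: there is an injection $f\colon X\to Y$ such that, for all $q\in X$ and $a\in A_b$, $f(q\cdot a)=f(q)\cdot a$ if $q\cdot a\in X$, and $f(q)\cdot a=q\cdot a$ if $q\cdot a\notin X$. -/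

import Mathlib

namespace UPC

/-! ## Automata

Complete deterministic automata are Mathlib's `DFA`; the digit alphabet in base `b` is `Fin b`. -/

section Automata

variable {α σ : Type*}

/-- The minimal automaton of its language: every state is reachable from the initial state, and
distinct states accept distinct languages. -/
def IsMinimal (A : DFA α σ) : Prop :=
  (∀ q, ∃ w, A.eval w = q) ∧ Function.Injective A.acceptsFrom

/-- The state `r` can be reached from the state `q`. -/
def Reach (A : DFA α σ) (q r : σ) : Prop := ∃ w, A.evalFrom q w = r

/-- Strong connectivity, an equivalence relation on the states. -/
def strongConn (A : DFA α σ) : Setoid σ where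
  r q r := Reach A q r ∧ Reach A r q
  iseqv :=
    { refl := fun _ => ⟨⟨[], rfl⟩, ⟨[], rfl⟩⟩
      symm := fun h => ⟨h.2, h.1⟩
      trans := by
        rintro q r s ⟨⟨u, hu⟩, ⟨v, hv⟩⟩ ⟨⟨u', hu'⟩, ⟨v', hv'⟩⟩
        exact ⟨⟨u ++ u', by rw [DFA.evalFrom_of_append, hu, hu']⟩,
          ⟨v' ++ v, by rw [DFA.evalFrom_of_append, hv', hv]⟩⟩ }

/-- The strongly connected components (SCCs) of `A`. -/
def SCC (A : DFA α σ) : Type _ := Quotient (strongConn A)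

/-- The component of a state. -/
def sccOf (A : DFA α σ) (q : σ) : SCC A := Quotient.mk (strongConn A) q

/-- The set of states of a component. -/
def states {A : DFA α σ} (x : SCC A) : Set σ := {q | sccOf A q = x}

/-- The condensation of `A`: the directed graph (with loops) on the components, with an edge from
`x` to `y` when some transition leads from a state of `x` to a state of `y`. -/
def condensation (A : DFA α σ) : Digraph (SCC A) where
  Adj x y := ∃ q ∈ states x, ∃ a, A.step q a ∈ states y

/-- `y` is a successor of `x` in the condensation, the loop at `x` being disregarded. -/
def IsSucc {A : DFA α σ} (x y : SCC A) : Prop := (condensation A).Adj x y ∧ y ≠ x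

/-- A leaf of the condensation: a vertex without successors (other than itself). -/
def IsLeaf {A : DFA α σ} (x : SCC A) : Prop := ∀ y, ¬ IsSucc x y

/-- A component is non-trivial if it contains an internal transition. -/
def Nontriv {A : DFA α σ} (x : SCC A) : Prop := ∃ q ∈ states x, ∃ a, A.step q a ∈ states x

/-- The component `x` is embeddable in the component `y`. -/
def Embeddable {A : DFA α σ} (x y : SCC A) : Prop :=
  ∃ f : states x → states y, Function.Injective f ∧ ∀ (q : states x) (a : α),
    (∀ h : A.step q a ∈ states x, (f ⟨A.step q a, h⟩ : σ) = A.step (f q) a) ∧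
    (A.step q a ∉ states x → A.step (f q) a = A.step q a)

/-- The component `x`, for a suitable choice of the initial state in it, is a quotient of the
complete automaton `P`: there is a covering of `x` by `P`, that is, a map from the states of `P` onto
those of `x` which commutes with the transitions and which preserves and reflects finality. The
initial state of `x` is the image of that of `P`. -/
def IsQuotientOf {A : DFA α σ} {τ : Type*} (x : SCC A) (P : DFA α τ) : Prop :=
  ∃ φ : τ → σ, Set.range φ = states x ∧
    (∀ q a, φ (P.step q a) = A.step (φ q) a) ∧
    (∀ q, φ q ∈ A.accept ↔ q ∈ P.accept)

end Automata

/-! ## Pascal automata -/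

/-- The set of the natural numbers whose residue modulo `p` lies in `R`. -/
def residueSet (p : ℕ) (R : Set (ZMod p)) : Set ℕ := {n | (n : ZMod p) ∈ R}

/-- `E` is periodic of period `q`. -/
def IsPeriod (E : Set ℕ) (q : ℕ) : Prop := 0 < q ∧ ∃ S : Set (ZMod q), E = residueSet q S

/-- `(p, R)` are the canonical parameters of a Pascal automaton in base `b`: `p` is coprime to `b`,
and is the smallest period of the periodic set given by `R` modulo `p`. -/
def IsPascalParam (b p : ℕ) (R : Set (ZMod p)) : Prop :=
  p.Coprime b ∧ IsLeast {q | IsPeriod (residueSet p R) q} p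

/-- The least positive `ψ` with `b ^ ψ ≡ 1` modulo `p` (for `p` positive and coprime to `b`). -/
noncomputable def psi (b p : ℕ) : ℕ := orderOf (b : ZMod p)

/-- The automaton with states `ℤ/pℤ × ℤ/ψℤ`, transitions `(s, t) · a = (s + a b ^ t, t + 1)`,
initial state `(0, 0)` and final states `R × ℤ/ψℤ`. -/
noncomputable def pascal (b p : ℕ) (R : Set (ZMod p)) : DFA (Fin b) (ZMod p × ZMod (psi b p)) where
  step x a := (x.1 + ((a : ℕ) : ZMod p) * (b : ZMod p) ^ x.2.val, x.2 + 1)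
  start := (0, 0)
  accept := {x | x.1 ∈ R}

/-! ## The UP-criterion -/

section Criterion

variable {b : ℕ} {σ : Type*}

/-- Type 1: a (non-trivial) component with an internal transition labelled by a non-zero digit. -/
def IsType1 {A : DFA (Fin b) σ} (x : SCC A) : Prop :=
  ∃ q ∈ states x, ∃ a : Fin b, (a : ℕ) ≠ 0 ∧ A.step q a ∈ states x

/-- Type 2: a non-trivial component that is not of Type 1. -/
def IsType2 {A : DFA (Fin b) σ} (x : SCC A) : Prop := Nontriv x ∧ ¬ IsType1 x

/-- The component `x` is a simple circuit `c 0 → c 1 → ... → c (ℓ - 1) → c 0` labelled by `0`, and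
has no other internal transition. -/
def IsZeroCircuit {A : DFA (Fin b) σ} (x : SCC A) : Prop :=
  ∃ ℓ : ℕ, 0 < ℓ ∧ ∃ c : ZMod ℓ → σ, Function.Injective c ∧ Set.range c = states x ∧
    ∀ i (a : Fin b), ((a : ℕ) = 0 → A.step (c i) a = c (i + 1)) ∧
      ((a : ℕ) ≠ 0 → A.step (c i) a ∉ states x)

/-- The UP-criterion for a complete deterministic automaton over the digits in base `b`. -/
structure UPCriterion (A : DFA (Fin b) σ) : Prop where
  /-- The successor by `0` of a state is final if and only if the state is. -/
  up0 : ∀ q (a : Fin b), (a : ℕ) = 0 → (A.step q a ∈ A.accept ↔ q ∈ A.accept)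
  /-- Type 1 components are leaves. -/
  up1 : ∀ x : SCC A, IsType1 x → IsLeaf x
  /-- Type 2 components are `0`-circuits -/
  up2_circuit : ∀ x : SCC A, IsType2 x → IsZeroCircuit x
  /-- and have exactly one successor, which is a leaf. -/
  up2_succ : ∀ x : SCC A, IsType2 x → ∃ y, IsSucc x y ∧ (∀ z, IsSucc x z → z = y) ∧ IsLeaf y
  /-- Type 1 components are quotients of Pascal automata. -/
  up3 : ∀ x : SCC A, IsType1 x →
    ∃ (p : ℕ) (R : Set (ZMod p)), IsPascalParam b p R ∧ IsQuotientOf x (pascal b p R)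
  /-- A Type 2 component is embeddable in its successor. -/
  up4 : ∀ x y : SCC A, IsType2 x → IsSucc x y → Embeddable x y

end Criterion

/-! ## Random access machines

Programs of a word RAM with registers and arrays, both numbered by natural numbers; a program
mentions finitely many of them. Registers and array cells hold natural numbers below a word
bound `W`. The only arithmetic operations are addition and truncated subtraction, and each
instruction and each test costs one step. -/

/-- The contents of the registers and of the arrays. -/
structure State where
  reg : ℕ → ℕ
  arr : ℕ → ℕ → ℕ

/-- Assign the value `v` to register `d`. -/
def State.setReg (s : State) (d v : ℕ) : State :=
  { s with reg := Function.update s.reg d v }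

/-- Assign the value `v` to cell `i` of array `k`. -/
def State.setArr (s : State) (k i v : ℕ) : State :=
  { s with arr := Function.update s.arr k (Function.update (s.arr k) i v) }

/-- Tests compare two registers. -/
inductive Test where
  | lt (x y : ℕ)
  | eq (x y : ℕ)

/-- The outcome of a test. -/
def Test.Holds : Test → State → Prop
  | .lt x y, s => s.reg x < s.reg y
  | .eq x y, s => s.reg x = s.reg y

/-- Programs. -/
inductive Prog where
  | skip
  /-- register `d` becomes the constant `c` -/
  | const (d c : ℕ)
  /-- register `d` becomes register `x` -/
  | copy (d x : ℕ)
  /-- register `d` becomes the sum of registers `x` and `y` -/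
  | add (d x y : ℕ)
  /-- register `d` becomes the truncated difference of registers `x` and `y` -/
  | sub (d x y : ℕ)
  /-- register `d` becomes the cell of array `k` whose index is in register `x` -/
  | load (d k x : ℕ)
  /-- the cell of array `k` whose index is in register `x` becomes register `y` -/
  | store (k x y : ℕ)
  | seq (P Q : Prog)
  | ite (e : Test) (P Q : Prog)
  | while (e : Test) (P : Prog)

/-- `Exec W P s t s'`: with word bound `W`, the program `P` started in `s` halts in `s'` after
exactly `t` steps. A computation that would produce a value not below `W` has no result. -/
inductive Exec (W : ℕ) : Prog → State → ℕ → State → Prop where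
  | skip (s) : Exec W .skip s 1 s
  | const (s d c) (h : c < W) : Exec W (.const d c) s 1 (s.setReg d c)
  | copy (s d x) : Exec W (.copy d x) s 1 (s.setReg d (s.reg x))
  | add (s d x y) (h : s.reg x + s.reg y < W) :
      Exec W (.add d x y) s 1 (s.setReg d (s.reg x + s.reg y))
  | sub (s d x y) : Exec W (.sub d x y) s 1 (s.setReg d (s.reg x - s.reg y))
  | load (s d k x) : Exec W (.load d k x) s 1 (s.setReg d (s.arr k (s.reg x)))
  | store (s k x y) : Exec W (.store k x y) s 1 (s.setArr k (s.reg x) (s.reg y))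
  | seq {P Q s s₁ s₂ t₁ t₂} (h₁ : Exec W P s t₁ s₁) (h₂ : Exec W Q s₁ t₂ s₂) :
      Exec W (.seq P Q) s (t₁ + t₂) s₂
  | ite_true {e P Q s s₁ t} (h : e.Holds s) (h₁ : Exec W P s t s₁) :
      Exec W (.ite e P Q) s (t + 1) s₁
  | ite_false {e P Q s s₁ t} (h : ¬ e.Holds s) (h₁ : Exec W Q s t s₁) :
      Exec W (.ite e P Q) s (t + 1) s₁
  | while_true {e P s s₁ s₂ t₁ t₂} (h : e.Holds s) (h₁ : Exec W P s t₁ s₁)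
      (h₂ : Exec W (.while e P) s₁ t₂ s₂) : Exec W (.while e P) s (t₁ + t₂ + 1) s₂
  | while_false {e P s} (h : ¬ e.Holds s) : Exec W (.while e P) s 1 s

/-- Programs are deterministic: the number of steps and the final contents are unique. -/
theorem Exec.unique {W : ℕ} {P : Prog} {s s₁ s₂ : State} {t₁ t₂ : ℕ}
    (h₁ : Exec W P s t₁ s₁) (h₂ : Exec W P s t₂ s₂) : t₁ = t₂ ∧ s₁ = s₂ := by
  induction h₁ generalizing t₂ s₂ with
  | seq _ _ ih ih' =>
    cases h₂ with
    | seq g g' =>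
      obtain ⟨rfl, rfl⟩ := ih g
      obtain ⟨rfl, rfl⟩ := ih' g'
      exact ⟨rfl, rfl⟩
  | ite_true h _ ih =>
    cases h₂ with
    | ite_true _ g => obtain ⟨rfl, rfl⟩ := ih g; exact ⟨rfl, rfl⟩
    | ite_false h' _ => exact absurd h h'
  | ite_false h _ ih =>
    cases h₂ with
    | ite_true h' _ => exact absurd h' h
    | ite_false _ g => obtain ⟨rfl, rfl⟩ := ih g; exact ⟨rfl, rfl⟩
  | while_true h _ _ ih ih' =>
    cases h₂ with
    | while_true _ g g' =>
      obtain ⟨rfl, rfl⟩ := ih g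
      obtain ⟨rfl, rfl⟩ := ih' g'
      exact ⟨rfl, rfl⟩
    | while_false h' => exact absurd h h'
  | while_false h =>
    cases h₂ with
    | while_true h' _ _ => exact absurd h' h
    | while_false _ => exact ⟨rfl, rfl⟩
  | _ => cases h₂; exact ⟨rfl, rfl⟩

open Classical in
/-- The input of a program: an automaton over `Fin b` with the `n` states `0, ..., n - 1`, given by
its number of states (register 0), its initial state (register 1), its final states (array 0,
with 1 for final and 0 for non-final) and its transitions by each digit `a` (array `a + 1`).
All other registers and cells hold 0. -/
noncomputable def input {b n : ℕ} (A : DFA (Fin b) (Fin n)) : State where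
  reg d := if d = 0 then n else if d = 1 then (A.start : ℕ) else 0
  arr k i :=
    if hi : i < n then
      if k = 0 then (if (⟨i, hi⟩ : Fin n) ∈ A.accept then 1 else 0)
      else if hk : k - 1 < b then (A.step ⟨i, hi⟩ ⟨k - 1, hk⟩ : ℕ) else 0
    else 0

/-- The property `Φ` of automata is decidable in linear time on the minimal automata over `Fin b`:
for some program and some constant `C`, on every minimal automaton with `n` states the program,
with words bounded by `C * n` (that is, words of logarithmically many bits), halts within `C * n`
steps, with 1 in register 0 if the automaton has the property and with 0 there if not. -/
def LinearTimeOnMinimal (b : ℕ) (Φ : ∀ {n : ℕ}, DFA (Fin b) (Fin n) → Prop) : Prop :=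
  ∃ (P : Prog) (C : ℕ), ∀ (n : ℕ) (A : DFA (Fin b) (Fin n)), IsMinimal A →
    ∃ (t : ℕ) (s : State), Exec (C * n) P (input A) t s ∧ t ≤ C * n ∧
      (Φ A → s.reg 0 = 1) ∧ (¬ Φ A → s.reg 0 = 0)

end UPC

/-!
The core of an automaton is the largest set of states in which every state has a predecessor; it
contains all non-trivial components. Under the UP-criterion the digit 0 acts injectively on the
core, say as `z`. Let `g` be adding one, the map of the core with `z ∘ g` the action of the
digit 1. Then the digit `a` acts as `z ∘ g ^ a`, the carry law `g ∘ z = z ∘ g ^ b` holds, and `g`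
is injective on its image. Conversely, these laws imply the UP-criterion for a minimal automaton
in which 0 preserves finality: the components in the image of `g` are quotients of Pascal
automata, whose `p` is the period of `g`, and a component outside it is a circuit, which folds
into the image without changing the values of `g`.

Once the core is known, and the actions of 0 and 1 on it have been inverted by tables, the laws
are a bounded number of table lookups for each state. To find the core, delete the states without
predecessors repeatedly. All states being reachable, only the initial state can start the
deletion.
-/

namespace UPC

section Reachability

variable {α σ : Type*} {A : DFA α σ} {q r s : σ} {x : SCC A}

theorem Reach.refl (q : σ) : Reach A q q := ⟨[], rfl⟩

theorem Reach.trans : Reach A q r → Reach A r s → Reach A q s := by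
  rintro ⟨u, rfl⟩ ⟨v, rfl⟩
  exact ⟨u ++ v, DFA.evalFrom_of_append ..⟩

theorem Reach.step (q : σ) (a : α) : Reach A q (A.step q a) := ⟨[a], rfl⟩

theorem sccOf_eq_iff : sccOf A q = sccOf A r ↔ Reach A q r ∧ Reach A r q :=
  Quotient.eq (r := strongConn A)

theorem mem_states_sccOf (q : σ) : q ∈ states (sccOf A q) := rfl

theorem exists_mem_states (x : SCC A) : ∃ q, q ∈ states x := Quotient.exists_rep x

theorem reach_of_mem_states (hq : q ∈ states x) (hr : r ∈ states x) : Reach A q r :=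
  (sccOf_eq_iff.1 (hq.trans hr.symm)).1

theorem mem_states_of_reach (hq : q ∈ states x) (hqr : Reach A q r) (hrq : Reach A r q) :
    r ∈ states x :=
  (sccOf_eq_iff.2 ⟨hrq, hqr⟩).trans hq

theorem IsLeaf.step_mem_states (hx : IsLeaf x) (hq : q ∈ states x) (a : α) :
    A.step q a ∈ states x := by
  by_contra h
  exact hx (sccOf A (A.step q a)) ⟨⟨q, hq, a, mem_states_sccOf _⟩, h⟩

/-- Every state of `S` has a predecessor in `S`. -/
def IsPredClosed (A : DFA α σ) (S : Set σ) : Prop := ∀ r ∈ S, ∃ q ∈ S, ∃ a, A.step q a = r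

/-- The largest set of states in which every state has a predecessor: what is left of the automaton
when the states without predecessors are deleted repeatedly. -/
def core (A : DFA α σ) : Set σ := ⋃₀ {S | IsPredClosed A S}

theorem IsPredClosed.subset_core {S : Set σ} (hS : IsPredClosed A S) : S ⊆ core A :=
  Set.subset_sUnion_of_mem hS

theorem isPredClosed_core : IsPredClosed A (core A) := by
  rintro r ⟨S, hS, hr⟩
  obtain ⟨q, hq, a, rfl⟩ := hS r hr
  exact ⟨q, hS.subset_core hq, a, rfl⟩

theorem step_mem_core (hq : q ∈ core A) (a : α) : A.step q a ∈ core A := by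
  have h : IsPredClosed A (insert (A.step q a) (core A)) := by
    rintro r (rfl | hr)
    · exact ⟨q, .inr hq, a, rfl⟩
    · obtain ⟨s, hs, h⟩ := isPredClosed_core r hr
      exact ⟨s, .inr hs, h⟩
  exact h.subset_core (Set.mem_insert ..)

theorem Nontriv.isPredClosed (hx : Nontriv x) : IsPredClosed A (states x) := by
  obtain ⟨q, hq, a, ha⟩ := hx
  intro r hr
  obtain ⟨w, hw⟩ := reach_of_mem_states ha hr
  rcases List.eq_nil_or_concat' w with rfl | ⟨v, c, rfl⟩
  · exact ⟨q, hq, a, hw⟩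
  · rw [DFA.evalFrom_append_singleton] at hw
    refine ⟨A.evalFrom (A.step q a) v, mem_states_of_reach ha ⟨v, rfl⟩ ?_, c, hw⟩
    exact Reach.trans ⟨[c], hw⟩ (reach_of_mem_states hr ha)

theorem Nontriv.states_subset_core (hx : Nontriv x) : states x ⊆ core A :=
  hx.isPredClosed.subset_core

theorem exists_nontriv_reach_of_mem_core [Finite σ] (hq : q ∈ core A) :
    ∃ r, Nontriv (sccOf A r) ∧ Reach A r q := by
  let : Preorder σ :=
    { le := Reach A
      le_refl := Reach.refl
      le_trans := fun _ _ _ => Reach.trans }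
  -- A state of the core that reaches `q`, and is as far back as possible, lies on a cycle.
  obtain ⟨r, ⟨hr, hrq⟩, hmin⟩ :=
    (Set.toFinite {r | r ∈ core A ∧ Reach A r q}).exists_minimal ⟨q, hq, Reach.refl q⟩
  obtain ⟨s, hs, a, rfl⟩ := isPredClosed_core r hr
  have hsr : Reach A s (A.step s a) := Reach.step s a
  have hrs : Reach A (A.step s a) s := hmin ⟨hs, hsr.trans hrq⟩ hsr
  exact ⟨_, ⟨s, sccOf_eq_iff.2 ⟨hsr, hrs⟩, a, mem_states_sccOf _⟩, hrq⟩

end Reachability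

section Digits

variable {b : ℕ} {σ : Type*} {A : DFA (Fin b) σ} {q : σ} {x : SCC A} {a : ℕ}

/-- The successor of a state by a digit given as a natural number. Junk value: the state itself,
when the number is not a digit. -/
def stepNat (A : DFA (Fin b) σ) (a : ℕ) (q : σ) : σ := if h : a < b then A.step q ⟨a, h⟩ else q

theorem stepNat_of_lt (h : a < b) (q : σ) : stepNat A a q = A.step q ⟨a, h⟩ := dif_pos h

theorem step_eq_stepNat (q : σ) (a : Fin b) : A.step q a = stepNat A a q :=
  (stepNat_of_lt a.2 q).symm

theorem stepNat_mem_core (hq : q ∈ core A) (a : ℕ) : stepNat A a q ∈ core A := by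
  unfold stepNat
  split_ifs
  exacts [step_mem_core hq _, hq]

theorem IsLeaf.stepNat_mem_states (hx : IsLeaf x) (hq : q ∈ states x) (a : ℕ) :
    stepNat A a q ∈ states x := by
  unfold stepNat
  split_ifs
  exacts [hx.step_mem_states hq _, hq]

theorem IsLeaf.isType1 (hx : IsLeaf x) (hb : 2 ≤ b) : IsType1 x := by
  obtain ⟨q, hq⟩ := exists_mem_states x
  exact ⟨q, hq, ⟨1, hb⟩, one_ne_zero, hx.step_mem_states hq _⟩

theorem IsType1.nontriv (hx : IsType1 x) : Nontriv x :=
  let ⟨q, hq, a, _, h⟩ := hx; ⟨q, hq, a, h⟩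

theorem Nontriv.isType1_or_isType2 (h : Nontriv x) : IsType1 x ∨ IsType2 x :=
  (em (IsType1 x)).imp_right (⟨h, ·⟩)

theorem IsType2.step_notMem_states (hx : IsType2 x) (hq : q ∈ states x) {a : Fin b}
    (ha : (a : ℕ) ≠ 0) : A.step q a ∉ states x :=
  fun h => hx.2 ⟨q, hq, a, ha, h⟩

end Digits

/-- The laws that the transitions `δ a` by the digits `a` in base `b` obey on a set `K` of states
when reading a digit amounts to adding a multiple of it: if `r` is the state `q` plus one, which is
to say `δ 0 r = δ 1 q`, then the digit `a + 1` read at `q` acts as the digit `a` read at `r`, and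
the digit `b` carries: the digits `b - 1, 0` read at `r` act as `0, 1` read at `q`. -/
structure CarryLaws {σ : Type*} (b : ℕ) (δ : ℕ → σ → σ) (K : Set σ) : Prop where
  inj_zero : Set.InjOn (δ 0) K
  inj_one : Set.InjOn (δ 1) (δ 1 '' K)
  succ_digit : ∀ q ∈ K, ∀ r ∈ K, δ 0 r = δ 1 q → ∀ a, a + 1 < b → δ (a + 1) q = δ a r
  carry : ∀ q ∈ K, ∀ r ∈ K, δ 0 r = δ 1 q → δ 0 (δ (b - 1) r) = δ 1 (δ 0 q)

section Pascal

variable {b p : ℕ} {R : Set (ZMod p)}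

theorem psi_pos (hp : 0 < p) (h : p.Coprime b) : 0 < psi b p := by
  have : NeZero p := ⟨hp.ne'⟩
  obtain ⟨u, hu⟩ := (ZMod.isUnit_iff_coprime b p).2 h.symm
  rw [psi, ← hu, orderOf_units]
  exact orderOf_pos u

theorem IsPascalParam.pos (h : IsPascalParam b p R) : 0 < p := h.2.1.1

theorem pow_val_natCast_psi (h : 0 < psi b p) (m : ℕ) :
    (b : ZMod p) ^ (m : ZMod (psi b p)).val = (b : ZMod p) ^ m := by
  have : NeZero (psi b p) := ⟨h.ne'⟩
  rw [ZMod.val_natCast]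
  exact pow_mod_orderOf _ _

theorem pow_val_add_one_psi (h : 0 < psi b p) (t : ZMod (psi b p)) :
    (b : ZMod p) ^ (t + 1).val = (b : ZMod p) ^ t.val * b := by
  have : NeZero (psi b p) := ⟨h.ne'⟩
  conv_lhs => rw [← ZMod.natCast_zmod_val t, ← Nat.cast_succ, pow_val_natCast_psi h]
  exact pow_succ _ _

variable {σ : Type*} {A : DFA (Fin b) σ} {x : SCC A}

theorem IsQuotientOf.mapsTo_step {τ : Type*} {P : DFA (Fin b) τ} (hQ : IsQuotientOf x P)
    (a : Fin b) : Set.MapsTo (A.step · a) (states x) (states x) := by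
  obtain ⟨φ, hφ, hstep, -⟩ := hQ
  rw [← hφ]
  rintro _ ⟨s, rfl⟩
  exact ⟨_, hstep s a⟩

theorem IsQuotientOf.surjOn_step (hQ : IsQuotientOf x (pascal b p R)) (a : Fin b) :
    Set.SurjOn (A.step · a) (states x) (states x) := by
  obtain ⟨φ, hφ, hstep, -⟩ := hQ
  rw [← hφ]
  rintro _ ⟨⟨s, t⟩, rfl⟩
  refine ⟨φ (s - ((a : ℕ) : ZMod p) * (b : ZMod p) ^ (t - 1).val, t - 1), ⟨_, rfl⟩, ?_⟩
  simp only [← hstep, pascal, sub_add_cancel]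

theorem IsQuotientOf.injOn_stepNat [Finite σ] (hQ : IsQuotientOf x (pascal b p R)) {a : ℕ}
    (ha : a < b) : Set.InjOn (stepNat A a) (states x) := by
  have hm := hQ.mapsTo_step ⟨a, ha⟩
  have hs := hQ.surjOn_step ⟨a, ha⟩
  simp only [step_eq_stepNat] at hm hs
  rw [← hm.restrict_surjective_iff] at hs
  rw [← hm.restrict_inj]
  exact Finite.injective_iff_surjective.2 hs

theorem IsQuotientOf.carryLaws [Finite σ] (hQ : IsQuotientOf x (pascal b p R))
    (hP : IsPascalParam b p R) (hb : 2 ≤ b) : CarryLaws b (stepNat A) (states x) := by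
  have hinj := fun a (ha : a < b) => hQ.injOn_stepNat ha
  have hmem : stepNat A 1 '' states x ⊆ states x := by
    rintro _ ⟨q, hq, rfl⟩
    rw [stepNat_of_lt hb]
    exact hQ.mapsTo_step _ hq
  obtain ⟨φ, hφ, hstep, -⟩ := hQ
  have hψ := psi_pos hP.pos hP.1
  have hnat : ∀ a < b, ∀ s t,
      stepNat A a (φ (s, t)) = φ (s + a * (b : ZMod p) ^ t.val, t + 1) := by
    intro a ha s t
    rw [stepNat_of_lt ha, ← hstep]
    rfl
  have hsucc : ∀ s t, ∀ r ∈ states x, stepNat A 0 r = stepNat A 1 (φ (s, t)) →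
      r = φ (s + (b : ZMod p) ^ t.val, t) := by
    intro s t r hr h
    refine hinj 0 (by omega) hr (hφ ▸ ⟨_, rfl⟩) (h.trans ?_)
    rw [hnat 1 hb, hnat 0 (by omega)]
    simp
  refine ⟨hinj 0 (by omega), (hinj 1 hb).mono hmem, ?_, ?_⟩ <;>
    rw [← hφ] at * <;> rintro _ ⟨⟨s, t⟩, rfl⟩ r hr h <;> obtain rfl := hsucc s t r hr h
  · intro a ha
    rw [hnat _ ha, hnat _ (by omega)]
    congr 2
    push_cast
    ring
  · rw [hnat _ (by omega), hnat 0 (by omega), hnat 0 (by omega), hnat 1 hb,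
      pow_val_add_one_psi hψ, Nat.cast_sub (by omega)]
    congr 2
    push_cast
    ring

end Pascal

namespace UPCriterion

variable {b : ℕ} {σ : Type*} {A : DFA (Fin b) σ} {q : σ} {x : SCC A}

theorem nontriv_step (hA : UPCriterion A) (hb : 2 ≤ b) (hq : Nontriv (sccOf A q)) (a : Fin b) :
    Nontriv (sccOf A (A.step q a)) := by
  by_cases hs : A.step q a ∈ states (sccOf A q)
  · rwa [show sccOf A (A.step q a) = sccOf A q from hs]
  rcases hq.isType1_or_isType2 with h1 | h2
  · exact absurd ((hA.up1 _ h1).step_mem_states (mem_states_sccOf q) a) hs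
  · obtain ⟨y, -, huniq, hy⟩ := hA.up2_succ _ h2
    rw [huniq (sccOf A (A.step q a)) ⟨⟨q, mem_states_sccOf q, a, mem_states_sccOf _⟩, hs⟩]
    exact (hy.isType1 hb).nontriv

theorem nontriv_of_mem_core [Finite σ] (hA : UPCriterion A) (hb : 2 ≤ b) (hq : q ∈ core A) :
    Nontriv (sccOf A q) := by
  obtain ⟨r, hr, w, rfl⟩ := exists_nontriv_reach_of_mem_core hq
  clear hq
  induction w using List.reverseRecOn with
  | nil => exact hr
  | append_singleton w a ih =>
    rw [DFA.evalFrom_append_singleton]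
    exact hA.nontriv_step hb ih a

theorem zero_mem_states (hA : UPCriterion A) (hb : 2 ≤ b) (hx : Nontriv x) (hq : q ∈ states x) :
    stepNat A 0 q ∈ states x := by
  rcases hx.isType1_or_isType2 with h1 | h2
  · exact (hA.up1 _ h1).stepNat_mem_states hq _
  · obtain ⟨l, -, c, -, hc, hstep⟩ := hA.up2_circuit _ h2
    rw [stepNat_of_lt (show 0 < b by omega)]
    rw [← hc] at hq ⊢
    obtain ⟨i, rfl⟩ := hq
    exact ⟨i + 1, ((hstep i _).1 rfl).symm⟩

theorem injOn_zero_states [Finite σ] (hA : UPCriterion A) (hb : 2 ≤ b) (hx : Nontriv x) :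
    Set.InjOn (stepNat A 0) (states x) := by
  have h0 : 0 < b := by omega
  rcases hx.isType1_or_isType2 with h1 | h2
  · obtain ⟨p, R, -, hQ⟩ := hA.up3 _ h1
    exact hQ.injOn_stepNat h0
  · obtain ⟨l, -, c, hc, hrange, hstep⟩ := hA.up2_circuit _ h2
    rw [← hrange]
    rintro _ ⟨i, rfl⟩ _ ⟨j, rfl⟩ h
    rw [stepNat_of_lt h0, stepNat_of_lt h0, (hstep i _).1 rfl, (hstep j _).1 rfl] at h
    rw [add_right_cancel (hc h)]

theorem inj_zero [Finite σ] (hA : UPCriterion A) (hb : 2 ≤ b) :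
    Set.InjOn (stepNat A 0) (core A) := by
  intro q hq r hr h
  have hq' := hA.nontriv_of_mem_core hb hq
  have hr' := hA.nontriv_of_mem_core hb hr
  have hqr : sccOf A r = sccOf A q := by
    rw [← hA.zero_mem_states hb hq' rfl, ← hA.zero_mem_states hb hr' rfl, h]
  exact hA.injOn_zero_states hb hq' rfl hqr h

/-- A state of the core behaves as a state of a Type 1 component as soon as a non-zero digit is
read. -/
theorem exists_shadow [Finite σ] (hA : UPCriterion A) (hb : 2 ≤ b) (hq : q ∈ core A) :
    ∃ y : SCC A, IsType1 y ∧ ∃ r ∈ states y, (∀ a, a ≠ 0 → a < b → stepNat A a q = stepNat A a r) ∧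
      stepNat A 1 (stepNat A 0 q) = stepNat A 1 (stepNat A 0 r) := by
  have hnt := hA.nontriv_of_mem_core hb hq
  rcases hnt.isType1_or_isType2 with h1 | h2
  · exact ⟨_, h1, q, rfl, fun _ _ _ => rfl, rfl⟩
  obtain ⟨y, hy, -, hleaf⟩ := hA.up2_succ _ h2
  obtain ⟨f, -, hf⟩ := hA.up4 _ y h2 hy
  have hnonzero : ∀ (r : states (sccOf A q)) (a : ℕ), a ≠ 0 → a < b →
      stepNat A a r = stepNat A a (f r) := by
    intro r a ha hab
    rw [stepNat_of_lt hab, stepNat_of_lt hab,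
      (hf r ⟨a, hab⟩).2 (h2.step_notMem_states r.2 ha)]
  have hzero := hA.zero_mem_states hb hnt (mem_states_sccOf q)
  have hfzero : (f ⟨stepNat A 0 q, hzero⟩ : σ) = stepNat A 0 (f ⟨q, rfl⟩) := by
    have h0 : 0 < b := by omega
    simp only [stepNat_of_lt h0] at hzero ⊢
    exact (hf ⟨q, rfl⟩ ⟨0, h0⟩).1 hzero
  refine ⟨y, hleaf.isType1 hb, f ⟨q, rfl⟩, (f ⟨q, rfl⟩).2, hnonzero ⟨q, rfl⟩, ?_⟩
  rw [← hfzero]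
  exact hnonzero ⟨_, hzero⟩ 1 one_ne_zero hb

theorem carryLaws_states [Finite σ] (hA : UPCriterion A) (hb : 2 ≤ b) (hx : IsType1 x) :
    CarryLaws b (stepNat A) (states x) :=
  let ⟨_, _, hP, hQ⟩ := hA.up3 x hx; hQ.carryLaws hP hb

theorem inj_one [Finite σ] (hA : UPCriterion A) (hb : 2 ≤ b) :
    Set.InjOn (stepNat A 1) (stepNat A 1 '' core A) := by
  rintro _ ⟨q, hq, rfl⟩ _ ⟨r, hr, rfl⟩ h
  obtain ⟨y, hy, s, hs, hqs, -⟩ := hA.exists_shadow hb hq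
  obtain ⟨y', hy', s', hs', hrs', -⟩ := hA.exists_shadow hb hr
  rw [hqs 1 one_ne_zero hb, hrs' 1 one_ne_zero hb] at h ⊢
  have hmem := (hA.up1 _ hy).stepNat_mem_states ((hA.up1 _ hy).stepNat_mem_states hs 1) 1
  have hmem' := (hA.up1 _ hy').stepNat_mem_states ((hA.up1 _ hy').stepNat_mem_states hs' 1) 1
  rw [h] at hmem
  obtain rfl : y = y' := hmem.symm.trans hmem'
  exact (hA.carryLaws_states hb hy).inj_one ⟨s, hs, rfl⟩ ⟨s', hs', rfl⟩ h

/-- The state `q` plus one lies in the Type 1 component of the shadow of `q`. -/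
theorem exists_shadow_of_step_eq [Finite σ] (hA : UPCriterion A) (hb : 2 ≤ b) {r : σ}
    (hq : q ∈ core A) (hr : r ∈ core A) (h : stepNat A 0 r = stepNat A 1 q) :
    ∃ y : SCC A, IsType1 y ∧ r ∈ states y ∧ ∃ s ∈ states y, stepNat A 0 r = stepNat A 1 s ∧
      (∀ a, a ≠ 0 → a < b → stepNat A a q = stepNat A a s) ∧
      stepNat A 1 (stepNat A 0 q) = stepNat A 1 (stepNat A 0 s) := by
  obtain ⟨y, hy, s, hs, hqs, hqs'⟩ := hA.exists_shadow hb hq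
  have hzero := hA.zero_mem_states hb (hA.nontriv_of_mem_core hb hr) rfl
  rw [h, hqs 1 one_ne_zero hb] at hzero
  exact ⟨y, hy, hzero.symm.trans ((hA.up1 _ hy).stepNat_mem_states hs 1), s, hs,
    h.trans (hqs 1 one_ne_zero hb), hqs, hqs'⟩

theorem carryLaws [Finite σ] (hA : UPCriterion A) (hb : 2 ≤ b) :
    CarryLaws b (stepNat A) (core A) where
  inj_zero := hA.inj_zero hb
  inj_one := hA.inj_one hb
  succ_digit q hq r hr h a ha := by
    obtain ⟨y, hy, hr, s, hs, hrs, hqs, -⟩ := hA.exists_shadow_of_step_eq hb hq hr h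
    rw [hqs (a + 1) a.succ_ne_zero ha]
    exact (hA.carryLaws_states hb hy).succ_digit s hs r hr hrs a ha
  carry q hq r hr h := by
    obtain ⟨y, hy, hr, s, hs, hrs, -, hqs⟩ := hA.exists_shadow_of_step_eq hb hq hr h
    rw [hqs]
    exact (hA.carryLaws_states hb hy).carry s hs r hr hrs

end UPCriterion

section FiniteMaps

variable {α σ : Type*} {A : DFA α σ} {f : σ → σ} {T : Set σ} {q : σ}

theorem reach_iterate (hm : Set.MapsTo f T T) (h : ∀ q ∈ T, Reach A q (f q)) (hq : q ∈ T) (k : ℕ) :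
    Reach A q (f^[k] q) := by
  induction k with
  | zero => exact Reach.refl q
  | succ k ih =>
    rw [Function.iterate_succ_apply']
    exact ih.trans (h _ (hm.iterate k hq))

variable [Finite σ]

theorem mem_periodicPts_of_injOn (hm : Set.MapsTo f T T) (hi : Set.InjOn f T) (hq : q ∈ T) :
    q ∈ Function.periodicPts f := by
  obtain ⟨n, hn, h⟩ := ((hm.restrict_inj).2 hi).mem_periodicPts ⟨q, hq⟩
  refine ⟨n, hn, ?_⟩
  have h' := congrArg Subtype.val h
  rwa [hm.iterate_restrict] at h'

theorem surjOn_of_injOn (hm : Set.MapsTo f T T) (hi : Set.InjOn f T) : Set.SurjOn f T T :=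
  hm.restrict_surjective_iff.1 (Finite.surjective_of_injective (hm.restrict_inj.2 hi))

theorem reach_symm_of_injOn (hm : Set.MapsTo f T T) (hi : Set.InjOn f T)
    (h : ∀ q ∈ T, Reach A q (f q)) (hq : q ∈ T) : Reach A (f q) q := by
  obtain ⟨n, hn, hper⟩ := mem_periodicPts_of_injOn hm hi hq
  have hback := reach_iterate hm h (hm hq) (n - 1)
  rwa [← Function.iterate_succ_apply, Nat.succ_eq_add_one, Nat.sub_add_cancel hn, hper] at hback

end FiniteMaps

theorem iterate_eq_of_natCast_eq {σ : Type*} {g : σ → σ} {i : σ} {s s' : ℕ}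
    (h : (s : ZMod (g.minimalPeriod i)) = s') : g^[s] i = g^[s'] i := by
  rw [ZMod.natCast_eq_natCast_iff'] at h
  rw [← Function.iterate_mod_minimalPeriod_eq, h, Function.iterate_mod_minimalPeriod_eq]

theorem coprime_of_forall_dvd_of_dvd_mul {p c : ℕ} (hp : 0 < p) (h : ∀ d, p ∣ d * c → p ∣ d) :
    p.Coprime c := by
  have hg : 0 < p.gcd c := Nat.gcd_pos_of_pos_left c hp
  have hdvd : p ∣ p / p.gcd c := h _ <| by
    rw [← Nat.mul_div_right_comm (Nat.gcd_dvd_left p c),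
      Nat.mul_div_assoc _ (Nat.gcd_dvd_right p c)]
    exact Nat.dvd_mul_right p _
  have hle := Nat.le_of_dvd (Nat.div_pos (Nat.gcd_le_left c hp) hg) hdvd
  by_contra hne
  exact absurd hle (Nat.div_lt_self hp (by omega)).not_ge

/-- On the set `Z`, the digit `a` acts as `z ∘ g ^ a`, where `z` is injective and
`g ∘ z = z ∘ g ^ b`: think of `g` as adding one, and of `z` as reading the digit zero. -/
structure DigitAction {b : ℕ} {σ : Type*} (A : DFA (Fin b) σ) (z g : σ → σ) (Z : Set σ) :
    Prop where
  mapsTo_z : Set.MapsTo z Z Z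
  mapsTo_g : Set.MapsTo g Z Z
  injOn_z : Set.InjOn z Z
  step_eq : ∀ q ∈ Z, ∀ a : Fin b, A.step q a = z (g^[a] q)
  g_z : ∀ q ∈ Z, g (z q) = z (g^[b] q)

/-- The residues `s` such that adding `s` to the state `i` gives a final state. -/
def finalResidues {α σ : Type*} (A : DFA α σ) (g : σ → σ) (i : σ) :
    Set (ZMod (g.minimalPeriod i)) :=
  {s | g^[s.val] i ∈ A.accept}

theorem mem_residueSet_finalResidues_iff {α σ : Type*} {A : DFA α σ} {g : σ → σ} {i : σ} {m : ℕ} :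
    m ∈ residueSet (g.minimalPeriod i) (finalResidues A g i) ↔ g^[m] i ∈ A.accept := by
  simp only [residueSet, finalResidues, Set.mem_ofPred_eq, ZMod.val_natCast,
    Function.iterate_mod_minimalPeriod_eq]

/-- The covering of the component of the state `i` by a Pascal automaton. -/
noncomputable def pascalMap {σ : Type*} (b : ℕ) (z g : σ → σ) (i : σ)
    (x : ZMod (g.minimalPeriod i) × ZMod (psi b (g.minimalPeriod i))) : σ :=
  z^[x.2.val] (g^[x.1.val] i)

namespace DigitAction

variable {b : ℕ} {σ : Type*} {A : DFA (Fin b) σ} {z g : σ → σ} {Z : Set σ} {q r i : σ} {x : SCC A}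

theorem mapsTo_step (D : DigitAction A z g Z) (a : Fin b) : Set.MapsTo (A.step · a) Z Z := by
  intro q hq
  simp only [D.step_eq q hq]
  exact D.mapsTo_z (D.mapsTo_g.iterate a hq)

theorem step_of_val_eq_zero (D : DigitAction A z g Z) (hq : q ∈ Z) {a : Fin b} (ha : (a : ℕ) = 0) :
    A.step q a = z q := by
  rw [D.step_eq q hq, ha, Function.iterate_zero_apply]

theorem iterate_g_z (D : DigitAction A z g Z) (hq : q ∈ Z) (k : ℕ) :
    g^[k] (z q) = z (g^[k * b] q) := by
  induction k with
  | zero => simp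
  | succ k ih =>
    rw [Function.iterate_succ_apply', ih, D.g_z _ (D.mapsTo_g.iterate _ hq),
      ← Function.iterate_add_apply, Nat.succ_mul, Nat.add_comm]

theorem iterate_g_iterate_z (D : DigitAction A z g Z) (hq : q ∈ Z) (t k : ℕ) :
    g^[k] (z^[t] q) = z^[t] (g^[k * b ^ t] q) := by
  induction t generalizing k with
  | zero => simp
  | succ t ih =>
    rw [Function.iterate_succ_apply', D.iterate_g_z (D.mapsTo_z.iterate _ hq), ih,
      Function.iterate_succ_apply', mul_assoc, ← pow_succ']

theorem iterate_mem (D : DigitAction A z g Z) (hq : q ∈ Z) (t s : ℕ) : z^[t] (g^[s] q) ∈ Z :=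
  D.mapsTo_z.iterate _ (D.mapsTo_g.iterate _ hq)

theorem step_iterate (D : DigitAction A z g Z) (hq : q ∈ Z) (t s : ℕ) (a : Fin b) :
    A.step (z^[t] (g^[s] q)) a = z^[t + 1] (g^[a * b ^ t + s] q) := by
  rw [D.step_eq _ (D.iterate_mem hq t s), D.iterate_g_iterate_z (D.mapsTo_g.iterate _ hq),
    ← Function.iterate_add_apply, Function.iterate_succ_apply']

theorem exists_evalFrom_eq (D : DigitAction A z g Z) (w : List (Fin b)) :
    ∃ t s, ∀ q ∈ Z, A.evalFrom q w = z^[t] (g^[s] q) := by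
  induction w using List.reverseRecOn with
  | nil => exact ⟨0, 0, fun _ _ => rfl⟩
  | append_singleton w a ih =>
    obtain ⟨t, s, h⟩ := ih
    refine ⟨t + 1, a * b ^ t + s, fun q hq => ?_⟩
    rw [DFA.evalFrom_append_singleton, h q hq, D.step_iterate hq]

theorem mem_of_reach (D : DigitAction A z g Z) (hq : q ∈ Z) (h : Reach A q r) : r ∈ Z := by
  obtain ⟨w, rfl⟩ := h
  obtain ⟨t, s, h⟩ := D.exists_evalFrom_eq w
  rw [h q hq]
  exact D.iterate_mem hq t s

theorem iterate_z_mem_accept (D : DigitAction A z g Z)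
    (hfin : ∀ q ∈ Z, z q ∈ A.accept ↔ q ∈ A.accept) (hq : q ∈ Z) (t : ℕ) :
    z^[t] q ∈ A.accept ↔ q ∈ A.accept := by
  induction t with
  | zero => rfl
  | succ t ih => rw [Function.iterate_succ_apply', hfin _ (D.mapsTo_z.iterate t hq), ih]

/-- The language of a state is determined by the finality of the states on its orbit under `g`. -/
theorem eq_of_iterate_mem_accept_iff (D : DigitAction A z g Z)
    (hfin : ∀ q ∈ Z, z q ∈ A.accept ↔ q ∈ A.accept) (hinj : Function.Injective A.acceptsFrom)
    (hq : q ∈ Z) (hr : r ∈ Z) (h : ∀ s, g^[s] q ∈ A.accept ↔ g^[s] r ∈ A.accept) : q = r := by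
  refine hinj (Language.ext fun w => ?_)
  obtain ⟨t, s, hw⟩ := D.exists_evalFrom_eq w
  simp only [DFA.mem_acceptsFrom, hw q hq, hw r hr]
  rw [D.iterate_z_mem_accept hfin (D.mapsTo_g.iterate s hq),
    D.iterate_z_mem_accept hfin (D.mapsTo_g.iterate s hr), h]

theorem iterate_psi_z (D : DigitAction A z g Z)
    (hfin : ∀ q ∈ Z, z q ∈ A.accept ↔ q ∈ A.accept) (hinj : Function.Injective A.acceptsFrom)
    (hi : i ∈ Z) (s : ℕ) : z^[psi b (g.minimalPeriod i)] (g^[s] i) = g^[s] i := by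
  have hs := D.mapsTo_g.iterate s hi
  refine D.eq_of_iterate_mem_accept_iff hfin hinj (D.mapsTo_z.iterate _ hs) hs fun k => ?_
  rw [D.iterate_g_iterate_z hs, D.iterate_z_mem_accept hfin (D.mapsTo_g.iterate _ hs),
    ← Function.iterate_add_apply, ← Function.iterate_add_apply,
    iterate_eq_of_natCast_eq (g := g) (s' := k + s)]
  push_cast
  rw [psi, pow_orderOf_eq_one, mul_one]

theorem pascalMap_natCast (D : DigitAction A z g Z)
    (hfin : ∀ q ∈ Z, z q ∈ A.accept ↔ q ∈ A.accept) (hinj : Function.Injective A.acceptsFrom)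
    (hi : i ∈ Z) (s t : ℕ) : pascalMap b z g i (s, t) = z^[t] (g^[s] i) := by
  simp only [pascalMap, ZMod.val_natCast, Function.iterate_mod_minimalPeriod_eq]
  exact Function.IsPeriodicPt.iterate_mod_apply (D.iterate_psi_z hfin hinj hi s) t

theorem reach_z (D : DigitAction A z g Z) (hb : 2 ≤ b) (hq : q ∈ Z) : Reach A q (z q) := by
  rw [← D.step_of_val_eq_zero hq (a := ⟨0, by omega⟩) rfl]
  exact Reach.step q _

variable [Finite σ]

theorem reach_z_symm (D : DigitAction A z g Z) (hb : 2 ≤ b) (hq : q ∈ Z) : Reach A (z q) q :=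
  reach_symm_of_injOn D.mapsTo_z D.injOn_z (fun _ => D.reach_z hb) hq

theorem reach_g (D : DigitAction A z g Z) (hb : 2 ≤ b) (hq : q ∈ Z) : Reach A q (g q) :=
  Reach.trans ⟨[⟨1, hb⟩], D.step_eq q hq ⟨1, hb⟩⟩ (D.reach_z_symm hb (D.mapsTo_g hq))

theorem reach_iterate (D : DigitAction A z g Z) (hb : 2 ≤ b) (hq : q ∈ Z) (t s : ℕ) :
    Reach A q (z^[t] (g^[s] q)) :=
  (UPC.reach_iterate D.mapsTo_g (fun _ => D.reach_g hb) hq s).trans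
    (UPC.reach_iterate D.mapsTo_z (fun _ => D.reach_z hb) (D.mapsTo_g.iterate s hq) t)

theorem z_mem_states (D : DigitAction A z g Z) (hb : 2 ≤ b) (hqZ : q ∈ Z) (hq : q ∈ states x) :
    z q ∈ states x :=
  mem_states_of_reach hq (D.reach_z hb hqZ) (D.reach_z_symm hb hqZ)

theorem reach_symm (D : DigitAction A z g Z) (hg : Set.InjOn g Z) (hq : q ∈ Z)
    (h : Reach A q r) : Reach A r q := by
  obtain ⟨w, rfl⟩ := h
  induction w generalizing q with
  | nil => exact Reach.refl q
  | cons a w ih =>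
    have hinj : Set.InjOn (A.step · a) Z := by
      intro q hq r hr h
      simp only [D.step_eq q hq, D.step_eq r hr] at h
      exact hg.iterate D.mapsTo_g a hq hr
        (D.injOn_z (D.mapsTo_g.iterate _ hq) (D.mapsTo_g.iterate _ hr) h)
    exact (ih (D.mapsTo_step a hq)).trans
      (reach_symm_of_injOn (D.mapsTo_step a) hinj (fun q _ => Reach.step q a) hq)

theorem mem_states_sccOf_iff (D : DigitAction A z g Z) (hg : Set.InjOn g Z) (hq : q ∈ Z) :
    r ∈ states (sccOf A q) ↔ Reach A q r :=
  ⟨fun h => reach_of_mem_states (mem_states_sccOf q) h,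
    fun h => mem_states_of_reach (mem_states_sccOf q) h (D.reach_symm hg hq h)⟩

theorem isLeaf (D : DigitAction A z g Z) (hg : Set.InjOn g Z) (hq : q ∈ Z) :
    IsLeaf (sccOf A q) := by
  rintro y ⟨⟨r, hr, a, ha⟩, hne⟩
  have hr' := (D.mem_states_sccOf_iff hg hq).1 hr
  exact hne (ha.symm.trans ((D.mem_states_sccOf_iff hg hq).2 (hr'.trans (Reach.step r a))))

theorem minimalPeriod_pos (D : DigitAction A z g Z) (hg : Set.InjOn g Z) (hi : i ∈ Z) :
    0 < g.minimalPeriod i :=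
  Function.minimalPeriod_pos_of_mem_periodicPts (mem_periodicPts_of_injOn D.mapsTo_g hg hi)

theorem coprime_minimalPeriod (D : DigitAction A z g Z) (hg : Set.InjOn g Z) (hi : i ∈ Z) :
    (g.minimalPeriod i).Coprime b := by
  obtain ⟨k, hk, hper⟩ := mem_periodicPts_of_injOn D.mapsTo_z D.injOn_z hi
  refine (Nat.coprime_pow_right_iff hk _ _).1
    (coprime_of_forall_dvd_of_dvd_mul (D.minimalPeriod_pos hg hi) fun d hd => ?_)
  rw [← Function.isPeriodicPt_iff_minimalPeriod_dvd] at hd ⊢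
  calc g^[d] i = g^[d] (z^[k] i) := by rw [hper]
    _ = z^[k] (g^[d * b ^ k] i) := D.iterate_g_iterate_z hi k d
    _ = i := by rw [hd, hper]

theorem isPascalParam (D : DigitAction A z g Z) (hg : Set.InjOn g Z)
    (hfin : ∀ q ∈ Z, z q ∈ A.accept ↔ q ∈ A.accept) (hinj : Function.Injective A.acceptsFrom)
    (hi : i ∈ Z) : IsPascalParam b (g.minimalPeriod i) (finalResidues A g i) := by
  refine ⟨D.coprime_minimalPeriod hg hi, ⟨D.minimalPeriod_pos hg hi, _, rfl⟩, ?_⟩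
  rintro m ⟨hm, S, hS⟩
  refine Function.IsPeriodicPt.minimalPeriod_le hm
    (D.eq_of_iterate_mem_accept_iff hfin hinj (D.mapsTo_g.iterate m hi) hi fun s => ?_)
  rw [← Function.iterate_add_apply, ← mem_residueSet_finalResidues_iff,
    ← mem_residueSet_finalResidues_iff, hS]
  simp [residueSet]

theorem range_pascalMap (D : DigitAction A z g Z) (hb : 2 ≤ b) (hg : Set.InjOn g Z)
    (hfin : ∀ q ∈ Z, z q ∈ A.accept ↔ q ∈ A.accept) (hinj : Function.Injective A.acceptsFrom)
    (hi : i ∈ Z) : Set.range (pascalMap b z g i) = states (sccOf A i) := by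
  ext r
  rw [D.mem_states_sccOf_iff hg hi]
  constructor
  · rintro ⟨x, rfl⟩
    exact D.reach_iterate hb hi _ _
  · rintro ⟨w, rfl⟩
    obtain ⟨t, s, hw⟩ := D.exists_evalFrom_eq w
    exact ⟨(s, t), by rw [D.pascalMap_natCast hfin hinj hi, hw i hi]⟩

theorem pascalMap_step (D : DigitAction A z g Z) (hg : Set.InjOn g Z)
    (hfin : ∀ q ∈ Z, z q ∈ A.accept ↔ q ∈ A.accept) (hinj : Function.Injective A.acceptsFrom)
    (hi : i ∈ Z) (x : ZMod (g.minimalPeriod i) × ZMod (psi b (g.minimalPeriod i))) (a : Fin b) :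
    pascalMap b z g i ((pascal b (g.minimalPeriod i) (finalResidues A g i)).step x a) =
      A.step (pascalMap b z g i x) a := by
  have hpos := D.minimalPeriod_pos hg hi
  have : NeZero (g.minimalPeriod i) := ⟨hpos.ne'⟩
  have : NeZero (psi b (g.minimalPeriod i)) := ⟨(psi_pos hpos (D.coprime_minimalPeriod hg hi)).ne'⟩
  have hstep : (pascal b (g.minimalPeriod i) (finalResidues A g i)).step x a =
      (((a * b ^ x.2.val + x.1.val : ℕ) : ZMod _), ((x.2.val + 1 : ℕ) : ZMod _)) := by
    simp [pascal, add_comm]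
  rw [hstep, D.pascalMap_natCast hfin hinj hi, ← D.step_iterate hi]
  rfl

theorem isQuotientOf (D : DigitAction A z g Z) (hb : 2 ≤ b) (hg : Set.InjOn g Z)
    (hfin : ∀ q ∈ Z, z q ∈ A.accept ↔ q ∈ A.accept) (hinj : Function.Injective A.acceptsFrom)
    (hi : i ∈ Z) :
    IsQuotientOf (sccOf A i) (pascal b (g.minimalPeriod i) (finalResidues A g i)) :=
  ⟨pascalMap b z g i, D.range_pascalMap hb hg hfin hinj hi, D.pascalMap_step hg hfin hinj hi,
    fun _ => D.iterate_z_mem_accept hfin (D.mapsTo_g.iterate _ hi) _⟩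

end DigitAction

/-- The map `f` folds `Z` into `g '' Z`, where `g` will be injective, without changing the images
under `g`, hence without changing the action of the non-zero digits. -/
structure IsShadow {σ : Type*} (g f : σ → σ) (Z : Set σ) : Prop where
  mapsTo : Set.MapsTo f Z (g '' Z)
  apply_eq : ∀ q ∈ Z, g (f q) = g q

theorem IsShadow.iterate_eq {σ : Type*} {g f : σ → σ} {Z : Set σ} {q : σ} (hf : IsShadow g f Z)
    (hq : q ∈ Z) {k : ℕ} (hk : k ≠ 0) : g^[k] (f q) = g^[k] q := by
  obtain ⟨m, rfl⟩ := Nat.exists_eq_succ_of_ne_zero hk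
  rw [Function.iterate_succ_apply, Function.iterate_succ_apply, hf.apply_eq q hq]

namespace DigitAction

variable {b : ℕ} {σ : Type*} {A : DFA (Fin b) σ} {z g f : σ → σ} {Z : Set σ} {q r : σ}
  {x y : SCC A}

theorem step_shadow (D : DigitAction A z g Z) (hf : IsShadow g f Z) (hgZ : g '' Z ⊆ Z)
    (hq : q ∈ Z) {a : Fin b} (ha : (a : ℕ) ≠ 0) : A.step (f q) a = A.step q a := by
  rw [D.step_eq q hq, D.step_eq _ (hgZ (hf.mapsTo hq)), hf.iterate_eq hq ha]

theorem exists_iterate_z_eq (D : DigitAction A z g Z) (hx : IsType2 x) (hxZ : states x ⊆ Z)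
    (hq : q ∈ states x) (hr : r ∈ states x) : ∃ k, z^[k] q = r := by
  obtain ⟨w, hw⟩ := reach_of_mem_states hq hr
  induction w generalizing q with
  | nil => exact ⟨0, hw⟩
  | cons a w ih =>
    have hqa : A.step q a ∈ states x :=
      mem_states_of_reach hq (Reach.step q a) (Reach.trans ⟨w, hw⟩ (reach_of_mem_states hr hq))
    have ha : (a : ℕ) = 0 := by
      by_contra ha
      exact hx.step_notMem_states hq ha hqa
    obtain ⟨k, hk⟩ := ih hqa hw
    exact ⟨k + 1, by rw [Function.iterate_succ_apply, ← D.step_of_val_eq_zero (hxZ hq) ha, hk]⟩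

variable [Finite σ]

theorem image (D : DigitAction A z g Z) (hg : Set.InjOn g (g '' Z)) :
    DigitAction A z g (g '' Z) := by
  have hsub : g '' Z ⊆ Z := D.mapsTo_g.image_subset
  have hmaps : Set.MapsTo g (g '' Z) (g '' Z) := fun q hq => ⟨q, hsub hq, rfl⟩
  refine ⟨fun q hq => ?_, hmaps, D.injOn_z.mono hsub, fun q hq => D.step_eq q (hsub hq),
    fun q hq => D.g_z q (hsub hq)⟩
  obtain ⟨r, hr, rfl⟩ := (surjOn_of_injOn hmaps hg).iterate b hq
  exact ⟨z r, D.mapsTo_z (hsub hr), D.g_z r (hsub hr)⟩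

theorem exists_isShadow (D : DigitAction A z g Z) (hg : Set.InjOn g (g '' Z)) :
    ∃ f, IsShadow g f Z := by
  have hsurj := surjOn_of_injOn (D.image hg).mapsTo_g hg
  choose! f hf hgf using fun q (hq : q ∈ Z) => hsurj ⟨q, hq, rfl⟩
  exact ⟨f, hf, hgf⟩

theorem step_mem_image (D : DigitAction A z g Z) (hg : Set.InjOn g (g '' Z)) (hq : q ∈ Z)
    {a : Fin b} (ha : (a : ℕ) ≠ 0) : A.step q a ∈ g '' Z := by
  rw [D.step_eq q hq]
  refine (D.image hg).mapsTo_z ⟨g^[(a : ℕ) - 1] q, D.mapsTo_g.iterate _ hq, ?_⟩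
  rw [← Function.iterate_succ_apply' g, Nat.succ_eq_add_one, Nat.sub_add_cancel (by omega)]

theorem states_subset_image (D : DigitAction A z g Z) (hg : Set.InjOn g (g '' Z)) (hx : IsType1 x)
    (hxZ : states x ⊆ Z) : states x ⊆ g '' Z := by
  obtain ⟨q, hq, a, ha, hqa⟩ := hx
  exact fun r hr =>
    (D.image hg).mem_of_reach (D.step_mem_image hg (hxZ hq) ha) (reach_of_mem_states hqa hr)

theorem shadow_z (D : DigitAction A z g Z) (hb : 2 ≤ b) (hg : Set.InjOn g (g '' Z))
    (hf : IsShadow g f Z) (hq : q ∈ Z) : f (z q) = z (f q) := by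
  have D' := D.image hg
  have hfq := hf.mapsTo hq
  refine hg (hf.mapsTo (D.mapsTo_z hq)) (D'.mapsTo_z hfq) ?_
  rw [hf.apply_eq _ (D.mapsTo_z hq), D.g_z q hq, D'.g_z _ hfq, hf.iterate_eq hq (by omega)]

theorem isZeroCircuit (D : DigitAction A z g Z) (hb : 2 ≤ b) (hx : IsType2 x)
    (hxZ : states x ⊆ Z) : IsZeroCircuit x := by
  obtain ⟨q, hq⟩ := exists_mem_states x
  have hpos : 0 < z.minimalPeriod q := Function.minimalPeriod_pos_of_mem_periodicPts
    (mem_periodicPts_of_injOn D.mapsTo_z D.injOn_z (hxZ hq))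
  have : NeZero (z.minimalPeriod q) := ⟨hpos.ne'⟩
  have hmem : ∀ k, z^[k] q ∈ states x := fun k =>
    (show Set.MapsTo z (states x) (states x) from
      fun r hr => D.z_mem_states hb (hxZ hr) hr).iterate k hq
  let c : ZMod (z.minimalPeriod q) → σ := fun i => z^[i.val] q
  have hc : ∀ k : ℕ, c k = z^[k] q := fun k => by
    simp only [c, ZMod.val_natCast, Function.iterate_mod_minimalPeriod_eq]
  refine ⟨z.minimalPeriod q, hpos, c, ?_, ?_, fun i a => ⟨fun ha => ?_, ?_⟩⟩
  · intro i j hij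
    exact ZMod.val_injective _ (Function.iterate_injOn_Iio_minimalPeriod
      (Set.mem_Iio.2 (ZMod.val_lt i)) (Set.mem_Iio.2 (ZMod.val_lt j)) hij)
  · refine Set.Subset.antisymm (Set.range_subset_iff.2 fun i => hmem _) fun r hr => ?_
    obtain ⟨k, rfl⟩ := D.exists_iterate_z_eq hx hxZ hq hr
    exact ⟨k, hc k⟩
  · obtain ⟨k, rfl⟩ := ZMod.natCast_zmod_surjective i
    rw [← Nat.cast_succ, hc, hc, D.step_of_val_eq_zero (hxZ (hmem k)) ha,
      Function.iterate_succ_apply']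
  · exact fun ha => hx.step_notMem_states (hmem _) ha

theorem sccOf_shadow_eq (D : DigitAction A z g Z) (hb : 2 ≤ b) (hg : Set.InjOn g (g '' Z))
    (hf : IsShadow g f Z) (hx : IsType2 x) (hxZ : states x ⊆ Z) (hq : q ∈ states x)
    (hr : r ∈ states x) : sccOf A (f r) = sccOf A (f q) := by
  obtain ⟨k, rfl⟩ := D.exists_iterate_z_eq hx hxZ hq hr
  clear hr
  induction k with
  | zero => rfl
  | succ k ih =>
    have hk := D.mapsTo_z.iterate k (hxZ hq)
    rw [Function.iterate_succ_apply', D.shadow_z hb hg hf hk, ← ih]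
    exact (D.image hg).z_mem_states hb (hf.mapsTo hk) (mem_states_sccOf _)

/-- The successor of a Type 2 component is that of the shadows of its states. -/
theorem isSucc_iff (D : DigitAction A z g Z) (hb : 2 ≤ b) (hg : Set.InjOn g (g '' Z))
    (hf : IsShadow g f Z) (hx : IsType2 x) (hxZ : states x ⊆ Z) (hq : q ∈ states x) :
    IsSucc x y ↔ y = sccOf A (f q) := by
  have hleaf : ∀ r ∈ states x, IsLeaf (sccOf A (f r)) := fun r hr =>
    (D.image hg).isLeaf hg (hf.mapsTo (hxZ hr))
  have hstep : ∀ r ∈ states x, ∀ a : Fin b, (a : ℕ) ≠ 0 → sccOf A (A.step r a) = sccOf A (f r) := by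
    intro r hr a ha
    rw [← D.step_shadow hf D.mapsTo_g.image_subset (hxZ hr) ha]
    exact (hleaf r hr).step_mem_states (mem_states_sccOf _) a
  constructor
  · rintro ⟨⟨r, hr, a, hra⟩, hne⟩
    have ha : (a : ℕ) ≠ 0 := by
      intro ha
      rw [D.step_of_val_eq_zero (hxZ hr) ha] at hra
      exact hne (hra.symm.trans (D.z_mem_states hb (hxZ hr) hr))
    rw [← D.sccOf_shadow_eq hb hg hf hx hxZ hq hr, ← hstep r hr a ha]
    exact hra.symm
  · rintro rfl
    refine ⟨⟨q, hq, ⟨1, hb⟩, hstep q hq _ one_ne_zero⟩, fun h => hx.2 ?_⟩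
    exact h ▸ (hleaf q hq).isType1 hb

theorem shadow_injOn (D : DigitAction A z g Z) (hb : 2 ≤ b) (hg : Set.InjOn g (g '' Z))
    (hf : IsShadow g f Z) (hfin : ∀ q ∈ Z, z q ∈ A.accept ↔ q ∈ A.accept)
    (hinj : Function.Injective A.acceptsFrom) (hx : IsType2 x) (hxZ : states x ⊆ Z) :
    Set.InjOn f (states x) := by
  suffices hlang : ∀ w : List (Fin b), ∀ q ∈ states x, ∀ r ∈ states x, f q = f r →
      (A.evalFrom q w ∈ A.accept ↔ A.evalFrom r w ∈ A.accept) from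
    fun q hq r hr h => hinj (Language.ext fun w => hlang w q hq r hr h)
  intro w
  induction w with
  | nil =>
    intro q hq r hr _
    obtain ⟨k, rfl⟩ := D.exists_iterate_z_eq hx hxZ hq hr
    exact (D.iterate_z_mem_accept hfin (hxZ hq) k).symm
  | cons a w ih =>
    intro q hq r hr hqr
    rw [DFA.evalFrom_cons, DFA.evalFrom_cons]
    by_cases ha : (a : ℕ) = 0
    · rw [D.step_of_val_eq_zero (hxZ hq) ha, D.step_of_val_eq_zero (hxZ hr) ha]
      refine ih _ (D.z_mem_states hb (hxZ hq) hq) _ (D.z_mem_states hb (hxZ hr) hr) ?_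
      rw [D.shadow_z hb hg hf (hxZ hq), D.shadow_z hb hg hf (hxZ hr), hqr]
    · have hgZ := D.mapsTo_g.image_subset
      rw [← D.step_shadow hf hgZ (hxZ hq) ha, ← D.step_shadow hf hgZ (hxZ hr) ha, hqr]

theorem embeddable (D : DigitAction A z g Z) (hb : 2 ≤ b) (hg : Set.InjOn g (g '' Z))
    (hf : IsShadow g f Z) (hfin : ∀ q ∈ Z, z q ∈ A.accept ↔ q ∈ A.accept)
    (hinj : Function.Injective A.acceptsFrom) (hx : IsType2 x) (hxZ : states x ⊆ Z)
    (hxy : IsSucc x y) : Embeddable x y := by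
  have hmem : Set.MapsTo f (states x) (states y) := fun q hq =>
    ((D.isSucc_iff hb hg hf hx hxZ hq).1 hxy).symm
  refine ⟨hmem.restrict, hmem.restrict_inj.2 (D.shadow_injOn hb hg hf hfin hinj hx hxZ),
    fun q a => ⟨fun hqa => ?_, fun hqa => ?_⟩⟩
  · have ha : (a : ℕ) = 0 := by
      by_contra ha
      exact hx.step_notMem_states q.2 ha hqa
    change f (A.step q a) = A.step (f q) a
    have hgZ := D.mapsTo_g.image_subset
    rw [D.step_of_val_eq_zero (hxZ q.2) ha,
      D.step_of_val_eq_zero (hgZ (hf.mapsTo (hxZ q.2))) ha, D.shadow_z hb hg hf (hxZ q.2)]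
  · refine D.step_shadow hf D.mapsTo_g.image_subset (hxZ q.2) fun ha => hqa ?_
    rw [D.step_of_val_eq_zero (hxZ q.2) ha]
    exact D.z_mem_states hb (hxZ q.2) q.2

theorem upCriterion (D : DigitAction A z g (core A)) (hb : 2 ≤ b)
    (hg : Set.InjOn g (g '' core A)) (hinj : Function.Injective A.acceptsFrom)
    (hfin : ∀ q (a : Fin b), (a : ℕ) = 0 → (A.step q a ∈ A.accept ↔ q ∈ A.accept)) :
    UPCriterion A := by
  have D' := D.image hg
  obtain ⟨f, hf⟩ := D.exists_isShadow hg
  have hz : ∀ q ∈ core A, z q ∈ A.accept ↔ q ∈ A.accept := by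
    intro q hq
    rw [← D.step_of_val_eq_zero hq (a := ⟨0, by omega⟩) rfl]
    exact hfin q _ rfl
  have h1 : ∀ x : SCC A, IsType1 x → states x ⊆ g '' core A := fun x hx =>
    D.states_subset_image hg hx hx.nontriv.states_subset_core
  refine
    { up0 := hfin
      up1 := fun x hx => ?_
      up2_circuit := fun x hx => D.isZeroCircuit hb hx hx.1.states_subset_core
      up2_succ := fun x hx => ?_
      up3 := fun x hx => ?_
      up4 := fun x y hx =>
        D.embeddable hb hg hf hz hinj hx hx.1.states_subset_core }
  · obtain ⟨q, rfl⟩ := exists_mem_states x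
    exact D'.isLeaf hg (h1 _ hx (mem_states_sccOf q))
  · obtain ⟨q, hq⟩ := exists_mem_states x
    have hsucc := fun y => D.isSucc_iff (y := y) hb hg hf hx hx.1.states_subset_core hq
    exact ⟨sccOf A (f q), (hsucc _).2 rfl, fun y => (hsucc y).1,
      D'.isLeaf hg (hf.mapsTo (hx.1.states_subset_core hq))⟩
  · obtain ⟨i, rfl⟩ := exists_mem_states x
    have hi := h1 _ hx (mem_states_sccOf i)
    have hz' := fun q (hq : q ∈ g '' core A) => hz q (D.mapsTo_g.image_subset hq)
    exact ⟨_, _, D'.isPascalParam hg hz' hinj hi, D'.isQuotientOf hb hg hz' hinj hi⟩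

end DigitAction

section CarryLaws

variable {b : ℕ} {σ : Type*} {A : DFA (Fin b) σ}

theorem CarryLaws.injOn_image (h : CarryLaws b (stepNat A) (core A)) (hb : 2 ≤ b) {g : σ → σ}
    (D : DigitAction A (stepNat A 0) g (core A))
    (hzg : ∀ q ∈ core A, stepNat A 0 (g q) = stepNat A 1 q) : Set.InjOn g (g '' core A) := by
  rintro _ ⟨u, hu, rfl⟩ _ ⟨v, hv, rfl⟩ huv
  -- The word `11` depends on `q` through `g (g q)` only.
  have h11 : ∀ q ∈ core A, stepNat A 1 (stepNat A 1 q) =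
      stepNat A 0 (stepNat A 0 (g^[b - 1] (g (g q)))) := by
    intro q hq
    rw [← hzg _ (stepNat_mem_core hq 1), ← hzg q hq, D.g_z _ (D.mapsTo_g hq),
      ← Function.iterate_succ_apply g (b - 1), Nat.succ_eq_add_one, Nat.sub_add_cancel (by omega)]
  refine h.inj_zero (D.mapsTo_g hu) (D.mapsTo_g hv) ?_
  rw [hzg u hu, hzg v hv]
  refine h.inj_one ⟨u, hu, rfl⟩ ⟨v, hv, rfl⟩ ?_
  rw [h11 u hu, h11 v hv, huv]

variable [Finite σ]

theorem CarryLaws.exists_digitAction (h : CarryLaws b (stepNat A) (core A)) (hb : 2 ≤ b) :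
    ∃ g, DigitAction A (stepNat A 0) g (core A) ∧
      ∀ q ∈ core A, stepNat A 0 (g q) = stepNat A 1 q := by
  have hmaps : ∀ a, Set.MapsTo (stepNat A a) (core A) (core A) :=
    fun a q hq => stepNat_mem_core hq a
  choose! g hg hzg using fun q (hq : q ∈ core A) =>
    surjOn_of_injOn (hmaps 0) h.inj_zero (hmaps 1 hq)
  have hstep : ∀ a < b, ∀ q ∈ core A, stepNat A a q = stepNat A 0 (g^[a] q) := by
    intro a
    induction a with
    | zero => intro _ q _; rfl
    | succ a ih =>
      intro ha q hq
      rw [h.succ_digit q hq (g q) (hg q hq) (hzg q hq) a ha, ih (by omega) _ (hg q hq),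
        Function.iterate_succ_apply]
  refine ⟨g, ⟨hmaps 0, hg, h.inj_zero, fun q hq a => ?_, fun q hq => ?_⟩, hzg⟩
  · rw [step_eq_stepNat, hstep _ a.2 q hq]
  · refine h.inj_zero (hg _ (hmaps 0 hq)) (hmaps 0 (Set.MapsTo.iterate hg b hq)) ?_
    calc stepNat A 0 (g (stepNat A 0 q)) = stepNat A 1 (stepNat A 0 q) := hzg _ (hmaps 0 hq)
      _ = stepNat A 0 (stepNat A (b - 1) (g q)) :=
        (h.carry q hq (g q) (hg q hq) (hzg q hq)).symm
      _ = stepNat A 0 (stepNat A 0 (g^[b] q)) := by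
        rw [hstep _ (by omega) _ (hg q hq), ← Function.iterate_succ_apply, Nat.succ_eq_add_one,
          Nat.sub_add_cancel (by omega)]

theorem upCriterion_iff_carryLaws (hb : 2 ≤ b) (hinj : Function.Injective A.acceptsFrom) :
    UPCriterion A ↔ (∀ q, stepNat A 0 q ∈ A.accept ↔ q ∈ A.accept) ∧
      CarryLaws b (stepNat A) (core A) := by
  constructor
  · refine fun hA => ⟨fun q => ?_, hA.carryLaws hb⟩
    rw [stepNat_of_lt (show 0 < b by omega)]
    exact hA.up0 q _ rfl
  · rintro ⟨hfin, h⟩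
    obtain ⟨g, D, hzg⟩ := h.exists_digitAction hb
    refine D.upCriterion hb (h.injOn_image hb D hzg) hinj fun q a ha => ?_
    rw [step_eq_stepNat, ha, hfin]

end CarryLaws

section Machine

variable {W n : ℕ} {P Q : Prog} {I J K Φ Ψ : State → Prop} {s : State}

@[simp] theorem State.setReg_arr (s : State) (d v : ℕ) : (s.setReg d v).arr = s.arr := rfl

@[simp] theorem State.setReg_reg_self (s : State) (d v : ℕ) : (s.setReg d v).reg d = v :=
  Function.update_self ..

@[simp] theorem State.setReg_reg_of_ne (s : State) {d x : ℕ} (v : ℕ) (h : x ≠ d) :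
    (s.setReg d v).reg x = s.reg x :=
  Function.update_of_ne h ..

@[simp] theorem State.setReg_setReg (s : State) (d v w : ℕ) :
    (s.setReg d v).setReg d w = s.setReg d w := by
  simp [State.setReg]

@[simp] theorem State.setArr_reg (s : State) (k i v : ℕ) : (s.setArr k i v).reg = s.reg := rfl

@[simp] theorem State.setArr_arr_self (s : State) (k i v : ℕ) :
    (s.setArr k i v).arr k = Function.update (s.arr k) i v :=
  Function.update_self ..

@[simp] theorem State.setArr_arr_of_ne (s : State) {k l : ℕ} (i v : ℕ) (h : l ≠ k) :
    (s.setArr k i v).arr l = s.arr l :=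
  Function.update_of_ne h ..

/-- The weakest precondition of a program without loops for halting in a state that satisfies `Φ`,
with word bound `W`. Junk value: it is false for loops. -/
def Prog.wp (W : ℕ) : Prog → (State → Prop) → State → Prop
  | .skip, Φ, s => Φ s
  | .const d c, Φ, s => c < W ∧ Φ (s.setReg d c)
  | .copy d x, Φ, s => Φ (s.setReg d (s.reg x))
  | .add d x y, Φ, s => s.reg x + s.reg y < W ∧ Φ (s.setReg d (s.reg x + s.reg y))
  | .sub d x y, Φ, s => Φ (s.setReg d (s.reg x - s.reg y))
  | .load d k x, Φ, s => Φ (s.setReg d (s.arr k (s.reg x)))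
  | .store k x y, Φ, s => Φ (s.setArr k (s.reg x) (s.reg y))
  | .seq P Q, Φ, s => P.wp W (Q.wp W Φ) s
  | .ite e P Q, Φ, s => (e.Holds s → P.wp W Φ s) ∧ (¬ e.Holds s → Q.wp W Φ s)
  | .while _ _, _, _ => False

/-- The time constant of a program: if its loops are not nested and are executed at most `n` times
each, where `n` is positive, then the program halts within `n` times this number of steps. -/
def Prog.size : Prog → ℕ
  | .seq P Q => P.size + Q.size
  | .ite _ P Q => P.size + Q.size + 1
  | .while _ P => P.size + 2
  | _ => 1

theorem Prog.wp.exec (h : P.wp W Φ s) : ∃ t s', Exec W P s t s' ∧ t ≤ P.size ∧ Φ s' := by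
  induction P generalizing s Φ with
  | skip => exact ⟨1, _, .skip s, le_rfl, h⟩
  | const d c => exact ⟨1, _, .const s d c h.1, le_rfl, h.2⟩
  | copy d x => exact ⟨1, _, .copy s d x, le_rfl, h⟩
  | add d x y => exact ⟨1, _, .add s d x y h.1, le_rfl, h.2⟩
  | sub d x y => exact ⟨1, _, .sub s d x y, le_rfl, h⟩
  | load d k x => exact ⟨1, _, .load s d k x, le_rfl, h⟩
  | store k x y => exact ⟨1, _, .store s k x y, le_rfl, h⟩
  | seq P Q ihP ihQ =>
    obtain ⟨t, s₁, hP, ht, h₁⟩ := ihP h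
    obtain ⟨t', s₂, hQ, ht', h₂⟩ := ihQ h₁
    exact ⟨t + t', s₂, .seq hP hQ, Nat.add_le_add ht ht', h₂⟩
  | ite e P Q ihP ihQ =>
    simp only [Prog.size]
    by_cases he : e.Holds s
    · obtain ⟨t, s', hP, ht, hΦ⟩ := ihP (h.1 he)
      exact ⟨t + 1, s', .ite_true he hP, by omega, hΦ⟩
    · obtain ⟨t, s', hQ, ht, hΦ⟩ := ihQ (h.2 he)
      exact ⟨t + 1, s', .ite_false he hQ, by omega, hΦ⟩
  | _ => exact h.elim

theorem Prog.wp.mono (h : P.wp W Φ s) (hΦ : ∀ s', Φ s' → Ψ s') : P.wp W Ψ s := by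
  induction P generalizing s Φ Ψ with
  | const | add => exact ⟨h.1, hΦ _ h.2⟩
  | seq P Q ihP ihQ => exact ihP h fun s' h' => ihQ h' hΦ
  | ite e P Q ihP ihQ => exact ⟨fun he => ihP (h.1 he) hΦ, fun he => ihQ (h.2 he) hΦ⟩
  | skip | copy | sub | load | store => exact hΦ _ h
  | _ => exact h.elim

/-- The program `P`, which has no loops, leads from the states that satisfy `I` to states that
satisfy `J`. -/
def Yields (W : ℕ) (P : Prog) (I J : State → Prop) : Prop := ∀ s, I s → P.wp W J s

theorem Yields.seq (hP : Yields W P I J) (hQ : Yields W Q J K) : Yields W (.seq P Q) I K :=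
  fun s hs => (hP s hs).mono hQ

/-- The consecutive execution of `f 0, ..., f (k - 1)`. -/
def unroll (f : ℕ → Prog) : ℕ → Prog
  | 0 => .skip
  | k + 1 => .seq (unroll f k) (f k)

theorem Yields.unroll {f : ℕ → Prog} {I : ℕ → State → Prop} {k : ℕ}
    (h : ∀ a < k, Yields W (f a) (I a) (I (a + 1))) : Yields W (unroll f k) (I 0) (I k) := by
  induction k with
  | zero => exact fun _ hs => hs
  | succ k ih => exact (ih fun a ha => h a (ha.trans k.lt_succ_self)).seq (h k k.lt_succ_self)

/-- The sequential composition of a list of programs. -/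
def block (l : List Prog) : Prog := l.foldr .seq .skip

@[simp] theorem wp_block_nil : (block []).wp W Φ s ↔ Φ s := Iff.rfl

@[simp] theorem wp_block_cons (P : Prog) (l : List Prog) :
    (block (P :: l)).wp W Φ s ↔ P.wp W ((block l).wp W Φ) s := Iff.rfl

/-- The program `P` leads from the states that satisfy `I` to states that satisfy `J` in time linear
in `n`. -/
def Runs (W n : ℕ) (P : Prog) (I J : State → Prop) : Prop :=
  ∀ s, I s → ∃ t s', Exec W P s t s' ∧ t ≤ P.size * n ∧ J s'

theorem Yields.runs (h : Yields W P I J) (hn : 0 < n) : Runs W n P I J := fun s hs =>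
  let ⟨t, s', hP, ht, hJ⟩ := (h s hs).exec
  ⟨t, s', hP, ht.trans (Nat.le_mul_of_pos_right _ hn), hJ⟩

theorem Runs.seq (hP : Runs W n P I J) (hQ : Runs W n Q J K) : Runs W n (.seq P Q) I K := by
  intro s hs
  obtain ⟨t, s₁, hP, ht, h₁⟩ := hP s hs
  obtain ⟨t', s₂, hQ, ht', h₂⟩ := hQ s₁ h₁
  exact ⟨t + t', s₂, .seq hP hQ, by simpa only [Prog.size, add_mul] using Nat.add_le_add ht ht', h₂⟩

theorem Yields.exec_while {e : Test} {I : ℕ → State → Prop} {N m j : ℕ}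
    (h : ∀ j < N, Yields W P (fun s => I j s ∧ e.Holds s) (I (j + 1)))
    (hN : ∀ s, I N s → ¬ e.Holds s) (hj : j + m = N) (hs : I j s) :
    ∃ t s', Exec W (.while e P) s t s' ∧ t ≤ (P.size + 1) * m + 1 ∧
      ∃ k ≤ N, I k s' ∧ ¬ e.Holds s' := by
  induction m generalizing j s with
  | zero =>
    obtain rfl : j = N := hj
    exact ⟨1, s, .while_false (hN s hs), by omega, j, le_rfl, hs, hN s hs⟩
  | succ m ih =>
    by_cases he : e.Holds s
    · obtain ⟨t, s₁, hP, ht, h₁⟩ := (h j (by omega) s ⟨hs, he⟩).exec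
      obtain ⟨t', s₂, hw, ht', h₂⟩ := ih (by omega) h₁
      exact ⟨_, s₂, .while_true he hP hw, by rw [Nat.mul_succ]; omega, h₂⟩
    · exact ⟨1, s, .while_false he, by omega, j, by omega, hs, he⟩

theorem Yields.runs_while {e : Test} {I : ℕ → State → Prop} (hn : 0 < n)
    (h : ∀ j < n, Yields W P (fun s => I j s ∧ e.Holds s) (I (j + 1)))
    (hN : ∀ s, I n s → ¬ e.Holds s) :
    Runs W n (.while e P) (I 0) fun s => ∃ j ≤ n, I j s ∧ ¬ e.Holds s := by
  intro s hs
  obtain ⟨t, s', hP, ht, hI⟩ := Yields.exec_while h hN (Nat.zero_add n) hs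
  refine ⟨t, s', hP, ht.trans ?_, hI⟩
  calc (P.size + 1) * n + 1 ≤ (P.size + 1) * n + n := Nat.add_le_add_left hn _
    _ = (Prog.while e P).size * n := by simp only [Prog.size]; ring

theorem Yields.runs_for {x y : ℕ} {I : ℕ → State → Prop} (hn : 0 < n)
    (h : ∀ j < n, Yields W P (I j) (I (j + 1))) (hx : ∀ j s, I j s → s.reg x = j)
    (hy : ∀ j s, I j s → s.reg y = n) : Runs W n (.while (.lt x y) P) (I 0) (I n) := by
  intro s hs
  obtain ⟨t, s', hP, ht, j, hjn, hj, he⟩ :=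
    Yields.runs_while (e := .lt x y) hn (fun j hj s hs => h j hj s hs.1)
      (fun s hs => by simp only [Test.Holds, hx _ _ hs, hy _ _ hs, lt_irrefl, not_false_eq_true])
      s hs
  simp only [Test.Holds, hx _ _ hj, hy _ _ hj, not_lt] at he
  exact ⟨t, s', hP, ht, le_antisymm hjn he ▸ hj⟩

end Machine

section InCount

variable {δ : ℕ → ℕ → ℕ} {E : Finset (ℕ × ℕ)} {n b q r a : ℕ}

/-- The number of the edges in `E` that lead to `r`, where the edge `(q, a)` leads to `δ a q`. -/
def inCount (δ : ℕ → ℕ → ℕ) (E : Finset (ℕ × ℕ)) (r : ℕ) : ℕ := {e ∈ E | δ e.2 e.1 = r}.card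

theorem inCount_ne_zero : inCount δ E r ≠ 0 ↔ ∃ q a, (q, a) ∈ E ∧ δ a q = r := by
  simp [inCount]

theorem inCount_insert (h : (q, a) ∉ E) :
    inCount δ (insert (q, a) E) =
      Function.update (inCount δ E) (δ a q) (inCount δ E (δ a q) + 1) := by
  ext r
  simp only [inCount, Finset.filter_insert, Function.update_apply]
  obtain rfl | hr := eq_or_ne r (δ a q)
  · rw [if_pos rfl, if_pos rfl, Finset.card_insert_of_notMem (by simp [h])]
  · rw [if_neg hr.symm, if_neg hr]

theorem inCount_erase (h : (q, a) ∈ E) :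
    inCount δ (E.erase (q, a)) =
      Function.update (inCount δ E) (δ a q) (inCount δ E (δ a q) - 1) := by
  conv_rhs => rw [← Finset.insert_erase h, inCount_insert (Finset.notMem_erase _ E)]
  simp

theorem inCount_le (hE : E ⊆ Finset.range n ×ˢ Finset.range b) (r : ℕ) : inCount δ E r ≤ n * b :=
  calc inCount δ E r ≤ E.card := Finset.card_filter_le _ _
    _ ≤ (Finset.range n ×ˢ Finset.range b).card := Finset.card_le_card hE
    _ = n * b := by simp

end InCount

section Peeling

variable {δ : ℕ → ℕ → ℕ} {n b h a T q r v : ℕ} {K : Set ℕ} {Q : ℕ → ℕ}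

/-- Every vertex in `S` is less than `n` and has a predecessor in `S` by a digit in base `b`. -/
def PredClosedBelow (δ : ℕ → ℕ → ℕ) (n b : ℕ) (S : Set ℕ) : Prop :=
  ∀ r ∈ S, r < n ∧ ∃ q ∈ S, ∃ a < b, δ a q = r

/-- The edges that remain when those from `Q 0, ..., Q (h - 1)` and the first `a` edges from `Q h`
have been deleted. -/
def remaining (n b : ℕ) (Q : ℕ → ℕ) (h a : ℕ) : Finset (ℕ × ℕ) :=
  {e ∈ Finset.range n ×ˢ Finset.range b | (∀ j < h, Q j ≠ e.1) ∧ (Q h = e.1 → a ≤ e.2)}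

theorem mem_remaining : (q, r) ∈ remaining n b Q h a ↔
    (q < n ∧ r < b) ∧ (∀ j < h, Q j ≠ q) ∧ (Q h = q → a ≤ r) := by
  simp [remaining]

theorem remaining_zero_zero : remaining n b Q 0 0 = Finset.range n ×ˢ Finset.range b := by
  simp [remaining]

theorem remaining_succ_zero : remaining n b Q (h + 1) 0 = remaining n b Q h b := by
  ext ⟨q, c⟩
  simp only [mem_remaining, Nat.forall_lt_succ_right, zero_le, implies_true, and_true]
  refine and_congr_right fun hlt => and_congr_right fun _ => ?_
  exact ⟨fun hne he => absurd he hne, fun hle he => (hle he).not_gt hlt.2⟩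

theorem remaining_succ : remaining n b Q h (a + 1) = (remaining n b Q h a).erase (Q h, a) := by
  ext ⟨q, c⟩
  simp only [Finset.mem_erase, mem_remaining, ne_eq, Prod.mk.injEq]
  grind

theorem remaining_update (hT : h < T) :
    remaining n b (Function.update Q T v) h a = remaining n b Q h a := by
  have hQ : ∀ j ≤ h, Function.update Q T v j = Q j :=
    fun j hj => Function.update_of_ne (hj.trans_lt hT).ne ..
  ext ⟨q, c⟩
  simp only [mem_remaining, hQ h le_rfl]
  exact and_congr_right fun _ => and_congr_left fun _ =>
    forall₂_congr fun j hj => by rw [hQ j hj.le]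

theorem mem_remaining_of_notMem_queue (hT : h < T) (hq : q < n) (ha : a < b)
    (hqQ : q ∉ Q '' Set.Iio T) {c : ℕ} : (q, a) ∈ remaining n b Q h c :=
  mem_remaining.2 ⟨⟨hq, ha⟩, fun j hj e => hqQ ⟨j, hj.trans hT, e⟩, fun e => absurd ⟨h, hT, e⟩ hqQ⟩

theorem eqOn_update_Iio : Set.EqOn (Function.update Q T v) Q (Set.Iio T) :=
  fun _ hj => Function.update_of_ne (ne_of_lt hj) ..

theorem image_update_Iio_succ :
    Function.update Q T v '' Set.Iio (T + 1) = insert v (Q '' Set.Iio T) := by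
  rw [← Order.succ_eq_add_one, Order.Iio_succ_eq_insert, Set.image_insert_eq,
    Function.update_self, eqOn_update_Iio.image_eq]

theorem injOn_update_Iio_succ (hQ : Set.InjOn Q (Set.Iio T)) (hv : v ∉ Q '' Set.Iio T) :
    Set.InjOn (Function.update Q T v) (Set.Iio (T + 1)) := by
  rw [← Order.succ_eq_add_one, Order.Iio_succ_eq_insert, Set.injOn_insert Set.self_notMem_Iio,
    Function.update_self, eqOn_update_Iio.image_eq]
  exact ⟨hQ.congr eqOn_update_Iio.symm, hv⟩

/-- The state of the deletion of the vertices without predecessors, when the queue holds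
`Q 0, ..., Q (T - 1)`, the edges from the first `h` vertices in the queue have been deleted, and `a`
of those from the next one. -/
structure Peeling (δ : ℕ → ℕ → ℕ) (n b : ℕ) (K : Set ℕ) (h a T : ℕ) (Q : ℕ → ℕ) : Prop where
  le : h ≤ T
  injOn : Set.InjOn Q (Set.Iio T)
  queue_eq : Q '' Set.Iio T = {r | r < n ∧ inCount δ (remaining n b Q h a) r = 0}
  disjoint : Disjoint K (Q '' Set.Iio T)

namespace Peeling

theorem init (hQ : Set.InjOn Q (Set.Iio T))
    (hT : Q '' Set.Iio T = {r | r < n ∧ inCount δ (Finset.range n ×ˢ Finset.range b) r = 0})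
    (hK : PredClosedBelow δ n b K) : Peeling δ n b K 0 0 T Q := by
  refine ⟨T.zero_le, hQ, by rwa [remaining_zero_zero], ?_⟩
  rw [hT, Set.disjoint_left]
  rintro r hr ⟨-, h0⟩
  obtain ⟨q, hq, a, ha, hqr⟩ := (hK r hr).2
  exact inCount_ne_zero.2 ⟨q, a, by simpa using ⟨(hK q hq).1, ha⟩, hqr⟩ h0

theorem queue_lt (P : Peeling δ n b K h a T Q) {j : ℕ} (hj : j < T) : Q j < n :=
  (P.queue_eq.subset ⟨j, hj, rfl⟩).1

theorem length_le (P : Peeling δ n b K h a T Q) : T ≤ n := by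
  simpa using Finset.card_le_card_of_injOn (s := Finset.range T) (t := Finset.range n) Q
    (fun j hj => by simpa using P.queue_lt (by simpa using hj)) (by simpa using P.injOn)

theorem next (P : Peeling δ n b K h b T Q) (hT : h < T) : Peeling δ n b K (h + 1) 0 T Q :=
  ⟨hT, P.injOn, by rw [remaining_succ_zero, P.queue_eq], P.disjoint⟩

theorem head_mem_remaining (P : Peeling δ n b K h a T Q) (hT : h < T) (ha : a < b) :
    (Q h, a) ∈ remaining n b Q h a :=
  mem_remaining.2 ⟨⟨P.queue_lt hT, ha⟩,
    fun _ hj e => hj.ne (P.injOn (hj.trans hT) hT e), fun _ => le_rfl⟩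

theorem inCount_remaining_succ (P : Peeling δ n b K h a T Q) (hT : h < T) (ha : a < b) :
    inCount δ (remaining n b Q h (a + 1)) =
      Function.update (inCount δ (remaining n b Q h a)) (δ a (Q h))
        (inCount δ (remaining n b Q h a) (δ a (Q h)) - 1) := by
  rw [remaining_succ, inCount_erase (P.head_mem_remaining hT ha)]

theorem notMem_queue (P : Peeling δ n b K h a T Q) (hT : h < T) (ha : a < b) :
    δ a (Q h) ∉ Q '' Set.Iio T := by
  rw [P.queue_eq]
  exact fun h0 => inCount_ne_zero.2 ⟨_, _, P.head_mem_remaining hT ha, rfl⟩ h0.2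

theorem digit_of_ne_zero (P : Peeling δ n b K h a T Q) (hT : h < T) (ha : a < b)
    (h0 : inCount δ (remaining n b Q h (a + 1)) (δ a (Q h)) ≠ 0) :
    Peeling δ n b K h (a + 1) T Q := by
  refine ⟨P.le, P.injOn, ?_, P.disjoint⟩
  have hv := P.notMem_queue hT ha
  rw [P.queue_eq] at hv ⊢
  ext r
  obtain rfl | hr := eq_or_ne r (δ a (Q h))
  · exact iff_of_false hv fun h => h0 h.2
  · simp only [Set.mem_ofPred_eq, P.inCount_remaining_succ hT ha, Function.update_of_ne hr]

theorem digit_of_eq_zero (P : Peeling δ n b K h a T Q) (hT : h < T) (ha : a < b)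
    (hK : PredClosedBelow δ n b K) (hδ : δ a (Q h) < n)
    (h0 : inCount δ (remaining n b Q h (a + 1)) (δ a (Q h)) = 0) :
    Peeling δ n b K h (a + 1) (T + 1) (Function.update Q T (δ a (Q h))) := by
  have hv := P.notMem_queue hT ha
  refine ⟨P.le.trans T.le_succ, injOn_update_Iio_succ P.injOn hv, ?_, ?_⟩
  · rw [image_update_Iio_succ, remaining_update hT, P.queue_eq]
    ext r
    obtain rfl | hr := eq_or_ne r (δ a (Q h))
    · exact iff_of_true (Set.mem_insert ..) ⟨hδ, h0⟩
    · simp only [Set.mem_insert_iff, hr, false_or, Set.mem_ofPred_eq,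
        P.inCount_remaining_succ hT ha, Function.update_of_ne hr]
  · rw [image_update_Iio_succ, Set.disjoint_insert_right]
    refine ⟨fun hm => ?_, P.disjoint⟩
    obtain ⟨q, hq, c, hc, hqc⟩ := (hK _ hm).2
    have hqQ : q ∉ Q '' Set.Iio T := Set.disjoint_left.1 P.disjoint hq
    exact inCount_ne_zero.2
      ⟨q, c, mem_remaining_of_notMem_queue hT (hK q hq).1 hc hqQ, hqc⟩ h0

theorem inCount_ne_zero_iff (P : Peeling δ n b K T 0 T Q)
    (hK : IsGreatest {S | PredClosedBelow δ n b S} K) (hr : r < n) :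
    inCount δ (remaining n b Q T 0) r ≠ 0 ↔ r ∈ K := by
  have hnotMem : ∀ q < n, q ∉ Q '' Set.Iio T ↔ inCount δ (remaining n b Q T 0) q ≠ 0 := by
    intro q hq
    rw [P.queue_eq, Set.mem_ofPred_eq, not_and_or, not_lt]
    exact ⟨fun h => h.resolve_left hq.not_ge, Or.inr⟩
  refine ⟨fun h0 => ?_, fun hrK => (hnotMem r hr).1 (Set.disjoint_left.1 P.disjoint hrK)⟩
  suffices PredClosedBelow δ n b {r | r < n ∧ inCount δ (remaining n b Q T 0) r ≠ 0} from
    hK.2 this ⟨hr, h0⟩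
  rintro r ⟨hr, h0⟩
  obtain ⟨q, a, hqa, rfl⟩ := inCount_ne_zero.1 h0
  obtain ⟨⟨hq, ha⟩, hne, -⟩ := mem_remaining.1 hqa
  refine ⟨hr, q, ⟨hq, (hnotMem q hq).1 ?_⟩, a, ha, rfl⟩
  rintro ⟨j, hj, e⟩
  exact hne j hj e

end Peeling

end Peeling

-- The input is given in the registers `size` and `start` and in the arrays `final` and `next a`.
namespace Reg

@[simp] abbrev size : ℕ := 0
@[simp] abbrev start : ℕ := 1
@[simp] abbrev cursor : ℕ := 2
@[simp] abbrev one : ℕ := 3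
@[simp] abbrev zero : ℕ := 4
@[simp] abbrev queueEnd : ℕ := 5
@[simp] abbrev source : ℕ := 6
@[simp] abbrev target : ℕ := 7
@[simp] abbrev value : ℕ := 8
@[simp] abbrev flag : ℕ := 9

end Reg

namespace Arr

@[simp] abbrev final : ℕ := 0
@[simp] abbrev next (a : ℕ) : ℕ := a + 1
@[simp] abbrev degree (b : ℕ) : ℕ := b + 1
@[simp] abbrev queue (b : ℕ) : ℕ := b + 2
@[simp] abbrev predZero (b : ℕ) : ℕ := b + 3
@[simp] abbrev predOne (b : ℕ) : ℕ := b + 4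

end Arr

section Frame

/-- What the program never changes once it has started: an automaton with `n` states, the initial
state `i`, the indicator `F` of the final states and the transitions `δ`, and the constants 0 and
1. -/
structure Frame (b n i : ℕ) (F : ℕ → ℕ) (δ : ℕ → ℕ → ℕ) (s : State) : Prop where
  size : s.reg Reg.size = n
  start : s.reg Reg.start = i
  one : s.reg Reg.one = 1
  zero : s.reg Reg.zero = 0
  final : s.arr Arr.final = F
  next : ∀ a < b, s.arr (Arr.next a) = δ a

variable {b n i d k v j : ℕ} {F : ℕ → ℕ} {δ : ℕ → ℕ → ℕ} {s : State}

theorem Frame.congr {s' : State} (h : Frame b n i F δ s)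
    (hreg : ∀ x < Reg.queueEnd, x ≠ Reg.cursor → s'.reg x = s.reg x)
    (harr : ∀ k ≤ b, s'.arr k = s.arr k) : Frame b n i F δ s' where
  size := (hreg _ (by decide) (by decide)).trans h.size
  start := (hreg _ (by decide) (by decide)).trans h.start
  one := (hreg _ (by decide) (by decide)).trans h.one
  zero := (hreg _ (by decide) (by decide)).trans h.zero
  final := (harr _ b.zero_le).trans h.final
  next a ha := (harr _ ha).trans (h.next a ha)

@[simp] theorem frame_setReg (hd : d = Reg.cursor ∨ Reg.queueEnd ≤ d) :
    Frame b n i F δ (s.setReg d v) ↔ Frame b n i F δ s := by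
  have hreg : ∀ x < Reg.queueEnd, x ≠ Reg.cursor → (s.setReg d v).reg x = s.reg x :=
    fun x hx hx' => State.setReg_reg_of_ne _ _ (by rintro rfl; exact hd.elim hx' hx.not_ge)
  exact ⟨fun h => h.congr (fun x hx hx' => (hreg x hx hx').symm) fun _ _ => rfl,
    fun h => h.congr hreg fun _ _ => rfl⟩

@[simp] theorem frame_setArr (hk : b < k) :
    Frame b n i F δ (s.setArr k j v) ↔ Frame b n i F δ s := by
  have harr : ∀ l ≤ b, (s.setArr k j v).arr l = s.arr l :=
    fun l hl => State.setArr_arr_of_ne _ _ _ (hl.trans_lt hk).ne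
  exact ⟨fun h => h.congr (fun _ _ _ => rfl) fun l hl => (harr l hl).symm,
    fun h => h.congr (fun _ _ _ => rfl) harr⟩

end Frame

section Count

variable {b n i W : ℕ} {F : ℕ → ℕ} {δ : ℕ → ℕ → ℕ}

/-- Count the transition by the digit `a` from the state under the cursor. -/
def countDigit (b a : ℕ) : Prog :=
  block [.load Reg.target (Arr.next a) Reg.cursor, .load Reg.value (Arr.degree b) Reg.target,
    .add Reg.value Reg.value Reg.one, .store (Arr.degree b) Reg.target Reg.value]

/-- Count the transitions from the state under the cursor. -/
def countBody (b : ℕ) : Prog :=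
  .seq (unroll (countDigit b) b) (.add Reg.cursor Reg.cursor Reg.one)

/-- Count the transitions to each state. -/
def countPhase (b : ℕ) : Prog :=
  .seq (.const Reg.one 1) (.while (.lt Reg.cursor Reg.size) (countBody b))

/-- The edges from the vertices below `j` and the first `a` edges from `j`. -/
def edgesUpTo (b j a : ℕ) : Finset (ℕ × ℕ) :=
  Finset.range j ×ˢ Finset.range b ∪ {j} ×ˢ Finset.range a

/-- The edges in `edgesUpTo b j a` have been counted. -/
structure Counted (b n i : ℕ) (F : ℕ → ℕ) (δ : ℕ → ℕ → ℕ) (j a : ℕ) (s : State) : Prop where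
  frame : Frame b n i F δ s
  cursor : s.reg Reg.cursor = j
  degree : s.arr (Arr.degree b) = inCount δ (edgesUpTo b j a)

theorem edgesUpTo_zero (b j : ℕ) : edgesUpTo b j 0 = Finset.range j ×ˢ Finset.range b := by
  simp [edgesUpTo]

theorem edgesUpTo_succ_right (b j a : ℕ) :
    edgesUpTo b j (a + 1) = insert (j, a) (edgesUpTo b j a) := by
  ext ⟨q, c⟩
  simp only [edgesUpTo, Finset.mem_insert, Finset.mem_union, Finset.mem_product, Finset.mem_range,
    Finset.mem_singleton, Prod.mk.injEq]
  omega

theorem edgesUpTo_self (b j : ℕ) : edgesUpTo b j b = edgesUpTo b (j + 1) 0 := by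
  ext ⟨q, c⟩
  simp only [edgesUpTo, Finset.mem_union, Finset.mem_product, Finset.mem_range,
    Finset.mem_singleton]
  omega

theorem edgesUpTo_subset {j a : ℕ} (hj : j < n) (ha : a ≤ b) :
    edgesUpTo b j a ⊆ Finset.range n ×ˢ Finset.range b := by
  rintro ⟨q, c⟩
  simp only [edgesUpTo, Finset.mem_union, Finset.mem_product, Finset.mem_range,
    Finset.mem_singleton]
  omega

theorem yields_countDigit (hW : n * b + n < W) {j a : ℕ} (hj : j < n) (ha : a < b) :
    Yields W (countDigit b a) (Counted b n i F δ j a) (Counted b n i F δ j (a + 1)) := by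
  rintro s ⟨hF, hj', hE⟩
  have : a ≠ b := ha.ne
  have hr : s.arr (Arr.next a) j = δ a j := by rw [hF.next a ha]
  have hle := inCount_le (δ := δ) (edgesUpTo_subset hj ha.le) (δ a j)
  simp only [countDigit, wp_block_cons, wp_block_nil, Prog.wp]
  refine ⟨?_, ?_, ?_, ?_⟩
  · simp [hj', hr, hE, hF.one]
    omega
  · simpa
  · simpa
  · rw [edgesUpTo_succ_right, inCount_insert (by simp [edgesUpTo])]
    simp [hj', hr, hE, hF.one]

theorem yields_countBody (hW : n * b + n < W) {j : ℕ} (hj : j < n) :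
    Yields W (countBody b) (Counted b n i F δ j 0) (Counted b n i F δ (j + 1) 0) := by
  refine (Yields.unroll (I := Counted b n i F δ j) fun a ha => yields_countDigit hW hj ha).seq ?_
  rintro s ⟨hF, hj', hE⟩
  refine ⟨by rw [hj', hF.one]; omega, by simpa, by simp [hj', hF.one], ?_⟩
  rw [State.setReg_arr, hE, edgesUpTo_self]

theorem runs_countPhase {A : DFA (Fin b) (Fin n)} (hW : n * b + n < W) (hn : 0 < n) :
    Runs W n (countPhase b) (· = input A) (Counted b n A.start ((input A).arr Arr.final)
      (fun a => (input A).arr (Arr.next a)) n 0) := by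
  refine Runs.seq (J := Counted b n A.start _ _ 0 0) (Yields.runs ?_ hn)
    (Yields.runs_for (I := fun j => Counted b n A.start _ _ j 0) hn
      (fun j hj => yields_countBody hW hj) (fun _ _ h => h.cursor) fun _ _ h => h.frame.size)
  rintro _ rfl
  refine ⟨by omega, ⟨?_, ?_, ?_, ?_, rfl, fun _ _ => rfl⟩, by simp [input], ?_⟩
  · simp [input]
  · simp [input]
  · simp
  · simp [input]
  · ext r
    simp [input, inCount, edgesUpTo]

end Count

section Peel

variable {b n i W h a : ℕ} {F : ℕ → ℕ} {δ : ℕ → ℕ → ℕ} {K : Set ℕ}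

/-- Put the initial state into the queue if it has no predecessor. -/
def pushStart (b : ℕ) : Prog :=
  block [.load Reg.value (Arr.degree b) Reg.start, .copy Reg.cursor Reg.zero,
    .copy Reg.queueEnd Reg.zero,
    .ite (.eq Reg.value Reg.zero)
      (block [.store (Arr.queue b) Reg.zero Reg.start, .copy Reg.queueEnd Reg.one]) .skip]

/-- Delete the transition by the digit `a` from the state in the queue under the cursor. -/
def peelDigit (b a : ℕ) : Prog :=
  block [.load Reg.source (Arr.queue b) Reg.cursor, .load Reg.target (Arr.next a) Reg.source,
    .load Reg.value (Arr.degree b) Reg.target, .sub Reg.value Reg.value Reg.one,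
    .store (Arr.degree b) Reg.target Reg.value,
    .ite (.eq Reg.value Reg.zero)
      (block [.store (Arr.queue b) Reg.queueEnd Reg.target,
        .add Reg.queueEnd Reg.queueEnd Reg.one]) .skip]

/-- Delete the transitions from the state in the queue under the cursor. -/
def peelBody (b : ℕ) : Prog :=
  .seq (unroll (peelDigit b) b) (.add Reg.cursor Reg.cursor Reg.one)

/-- Delete the states without predecessors until every state that is left has one. -/
def peelPhase (b : ℕ) : Prog :=
  .seq (pushStart b) (.while (.lt Reg.cursor Reg.queueEnd) (peelBody b))

/-- The memory during the deletion, as in `Peeling`. -/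
structure Peeled (b n i : ℕ) (F : ℕ → ℕ) (δ : ℕ → ℕ → ℕ) (K : Set ℕ) (h a : ℕ) (s : State) :
    Prop where
  frame : Frame b n i F δ s
  cursor : s.reg Reg.cursor = h
  degree : s.arr (Arr.degree b) = inCount δ (remaining n b (s.arr (Arr.queue b)) h a)
  peeling : Peeling δ n b K h a (s.reg Reg.queueEnd) (s.arr (Arr.queue b))

/-- The states in `K` are those of positive degree. -/
structure Marked (b n i : ℕ) (F : ℕ → ℕ) (δ : ℕ → ℕ → ℕ) (K : Set ℕ) (s : State) : Prop where
  frame : Frame b n i F δ s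
  degree_ne_zero : ∀ r < n, s.arr (Arr.degree b) r ≠ 0 ↔ r ∈ K

theorem yields_pushStart (hi : i < n) (hK : PredClosedBelow δ n b K)
    (hne : ∀ r < n, r ≠ i → inCount δ (Finset.range n ×ˢ Finset.range b) r ≠ 0) :
    Yields W (pushStart b) (Counted b n i F δ n 0) (Peeled b n i F δ K 0 0) := by
  rintro s ⟨hF, -, hE⟩
  rw [edgesUpTo_zero] at hE
  have hstart : {r | r < n ∧ inCount δ (Finset.range n ×ˢ Finset.range b) r = 0} ⊆ {i} :=
    fun r hr => by_contra fun hri => hne r hr.1 hri hr.2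
  simp only [pushStart, wp_block_cons, wp_block_nil, Prog.wp, Test.Holds]
  refine ⟨fun h0 => ?_, fun h0 => ?_⟩
  · replace h0 : inCount δ (Finset.range n ×ˢ Finset.range b) i = 0 := by
      simpa [hE, hF.start, hF.zero] using h0
    refine ⟨by simpa, by simp [hF.zero], by simp [hE, remaining_zero_zero],
      Peeling.init (by simp [hF.one]) ?_ hK⟩
    rw [hstart.antisymm (Set.singleton_subset_iff.2 ⟨hi, h0⟩)]
    simp [hF.one, hF.zero, hF.start]
  · replace h0 : inCount δ (Finset.range n ×ˢ Finset.range b) i ≠ 0 := by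
      simpa [hE, hF.start, hF.zero] using h0
    refine ⟨by simpa, by simp [hF.zero], by simp [hE, remaining_zero_zero],
      Peeling.init (by simp [hF.zero]) ?_ hK⟩
    rw [Set.eq_empty_of_forall_notMem fun r hr => h0 (hstart hr ▸ hr.2)]
    simp [hF.zero]

theorem yields_peelDigit (hW : n * b + n < W) (hK : PredClosedBelow δ n b K)
    (hδ : ∀ a < b, ∀ q < n, δ a q < n) (ha : a < b) :
    Yields W (peelDigit b a) (fun s => Peeled b n i F δ K h a s ∧ h < s.reg Reg.queueEnd)
      fun s => Peeled b n i F δ K h (a + 1) s ∧ h < s.reg Reg.queueEnd := by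
  rintro s ⟨⟨hF, hc, hE, P⟩, hT⟩
  have : a ≠ b := ha.ne
  have hr := congrFun (hF.next a ha)
  have hdec := P.inCount_remaining_succ hT ha
  simp only [peelDigit, wp_block_cons, wp_block_nil, Prog.wp, Test.Holds]
  refine ⟨fun h0 => ?_, fun h0 => ?_⟩
  · replace h0 : inCount δ (remaining n b (s.arr (Arr.queue b)) h (a + 1))
        (δ a (s.arr (Arr.queue b) h)) = 0 := by
      simpa [hdec, hc, hr, hE, hF.one, hF.zero] using h0
    have P' := P.digit_of_eq_zero hT ha hK (hδ a ha _ (P.queue_lt hT)) h0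
    have hlen := P'.length_le
    refine ⟨?_, ⟨?_, ?_, ?_, ?_⟩, ?_⟩
    · simpa [hF.one] using show s.reg Reg.queueEnd + 1 < W by omega
    · simpa
    · simpa
    · simp [hdec, remaining_update hT, hc, hr, hE, hF.one]
    · simpa [hc, hr, hF.one] using P'
    · simpa [hF.one] using hT.trans (Nat.lt_succ_self _)
  · replace h0 : inCount δ (remaining n b (s.arr (Arr.queue b)) h (a + 1))
        (δ a (s.arr (Arr.queue b) h)) ≠ 0 := by
      simpa [hdec, hc, hr, hE, hF.one, hF.zero] using h0
    refine ⟨⟨by simpa, by simpa, ?_, ?_⟩, by simpa⟩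
    · simp [hdec, hc, hr, hE, hF.one]
    · simpa using P.digit_of_ne_zero hT ha h0

theorem yields_peelBody (hW : n * b + n < W) (hK : PredClosedBelow δ n b K)
    (hδ : ∀ a < b, ∀ q < n, δ a q < n) :
    Yields W (peelBody b)
      (fun s => Peeled b n i F δ K h 0 s ∧ (Test.lt Reg.cursor Reg.queueEnd).Holds s)
      (Peeled b n i F δ K (h + 1) 0) := by
  refine Yields.seq (J := fun s => Peeled b n i F δ K h b s ∧ h < s.reg Reg.queueEnd) ?_ ?_
  · rintro s ⟨hs, hT⟩
    exact Yields.unroll (I := fun a s => Peeled b n i F δ K h a s ∧ h < s.reg Reg.queueEnd)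
      (fun a ha => yields_peelDigit hW hK hδ ha) s ⟨hs, by rwa [← hs.cursor]⟩
  · rintro s ⟨⟨hF, hc, hE, P⟩, hT⟩
    have hlen := P.length_le
    refine ⟨by rw [hc, hF.one]; omega, by simpa, by simp [hc, hF.one], ?_, ?_⟩
    · simpa [remaining_succ_zero] using hE
    · simpa using P.next hT

theorem runs_peelPhase (hW : n * b + n < W) (hK : IsGreatest {S | PredClosedBelow δ n b S} K)
    (hδ : ∀ a < b, ∀ q < n, δ a q < n) (hi : i < n)
    (hne : ∀ r < n, r ≠ i → inCount δ (Finset.range n ×ˢ Finset.range b) r ≠ 0) :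
    Runs W n (peelPhase b) (Counted b n i F δ n 0) (Marked b n i F δ K) := by
  have hn : 0 < n := by omega
  have hloop := Yields.runs_while (I := fun h => Peeled b n i F δ K h 0) hn
    (fun h _ => yields_peelBody hW hK.1 hδ) fun s hs => by
      simpa only [Test.Holds, hs.cursor, not_lt] using hs.peeling.length_le
  refine ((yields_pushStart hi hK.1 hne).runs hn).seq fun s hs => ?_
  obtain ⟨t, s', ht, hle, h, -, ⟨hF, hc, hE, P⟩, hend⟩ := hloop s hs
  refine ⟨t, s', ht, hle, hF, fun r hr => ?_⟩
  obtain rfl : h = s'.reg Reg.queueEnd :=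
    P.le.antisymm (by simpa only [Test.Holds, hc, not_lt] using hend)
  rw [hE, P.inCount_ne_zero_iff hK hr]

end Peel

section Lookup

variable {W d k : ℕ} {l l' : List ℕ} {Φ : State → Prop} {s : State}

/-- Look up the number under the cursor in the arrays in `l`, the last one first, and put the result
into register `d`. -/
def lookup (d : ℕ) : List ℕ → Prog
  | [] => .copy d Reg.cursor
  | k :: l => .seq (lookup d l) (.load d k d)

@[simp] theorem wp_lookup :
    (lookup d l).wp W Φ s ↔ Φ (s.setReg d (l.foldr s.arr (s.reg Reg.cursor))) := by
  induction l generalizing Φ with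
  | nil => rfl
  | cons k l ih => simp [lookup, Prog.wp, ih]

/-- Enter the result of the lookup in `l'` into the array `k` at the result of the lookup in `l`. -/
def tabulate (k : ℕ) (l l' : List ℕ) : Prog :=
  block [lookup Reg.target l, lookup Reg.value l', .store k Reg.target Reg.value]

theorem wp_tabulate :
    (tabulate k l l').wp W Φ s ↔
      Φ (((s.setReg Reg.target (l.foldr s.arr (s.reg Reg.cursor))).setReg Reg.value
        (l'.foldr s.arr (s.reg Reg.cursor))).setArr k (l.foldr s.arr (s.reg Reg.cursor))
          (l'.foldr s.arr (s.reg Reg.cursor))) := by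
  simp [tabulate, Prog.wp]

end Lookup

section Tabulates

variable {α β γ : Type*} {T : β → γ} {key : α → β} {val : α → γ} {S : Set α}

/-- For each `q` in `S`, the entry of the table `T` at the key of `q` is the value of an element of
`S` with the same key. -/
def Tabulates (T : β → γ) (key : α → β) (val : α → γ) (S : Set α) : Prop :=
  ∀ q ∈ S, ∃ r ∈ S, key r = key q ∧ T (key q) = val r

theorem tabulates_empty : Tabulates T key val ∅ := fun _ hq => hq.elim

theorem Tabulates.insert [DecidableEq β] (h : Tabulates T key val S) (q : α) :
    Tabulates (Function.update T (key q) (val q)) key val (insert q S) := by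
  intro r hr
  by_cases hqr : key r = key q
  · exact ⟨q, Set.mem_insert .., hqr.symm, by rw [hqr, Function.update_self]⟩
  · obtain ⟨p, hp, hpr, hT⟩ := h r (hr.resolve_left fun e => hqr (congrArg key e))
    exact ⟨p, Set.mem_insert_of_mem _ hp, hpr, by rw [Function.update_of_ne hqr, hT]⟩

theorem Tabulates.forall_eq_iff (h : Tabulates T key val S) :
    (∀ q ∈ S, T (key q) = val q) ↔ ∀ q ∈ S, ∀ r ∈ S, key q = key r → val q = val r := by
  refine ⟨fun hT q hq r hr e => by rw [← hT q hq, e, hT r hr], fun hval q hq => ?_⟩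
  obtain ⟨r, hr, e, hT⟩ := h q hq
  rw [hT, hval r hr q hq e]

end Tabulates

section Fill

variable {b n i W j : ℕ} {F : ℕ → ℕ} {δ : ℕ → ℕ → ℕ} {K : Set ℕ}

/-- If the state `q` under the cursor is marked, enter `q` into one table at `q · 0`, and `q · 1`
into the other one at `q · 1 · 1`. -/
def fillBody (b : ℕ) : Prog :=
  block [lookup Reg.value [Arr.degree b],
    .ite (.eq Reg.value Reg.zero) .skip
      (.seq (tabulate (Arr.predZero b) [Arr.next 0] [])
        (tabulate (Arr.predOne b) [Arr.next 1, Arr.next 1] [Arr.next 1])),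
    .add Reg.cursor Reg.cursor Reg.one]

/-- Tabulate the inverse of the digit 0 on the marked states, and that of the digit 1 on their
successors by 1. -/
def fillPhase (b : ℕ) : Prog :=
  .seq (.copy Reg.cursor Reg.zero) (.while (.lt Reg.cursor Reg.size) (fillBody b))

/-- The marked states below `j` have been entered into the tables. -/
structure Filled (b n i : ℕ) (F : ℕ → ℕ) (δ : ℕ → ℕ → ℕ) (K : Set ℕ) (j : ℕ) (s : State) :
    Prop where
  marked : Marked b n i F δ K s
  cursor : s.reg Reg.cursor = j
  predZero : Tabulates (s.arr (Arr.predZero b)) (δ 0) id (K ∩ Set.Iio j)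
  predOne : Tabulates (s.arr (Arr.predOne b)) (δ 1 ∘ δ 1) (δ 1) (K ∩ Set.Iio j)

theorem inter_Iio_succ_of_notMem (hj : j ∉ K) : K ∩ Set.Iio (j + 1) = K ∩ Set.Iio j := by
  rw [← Order.succ_eq_add_one, Order.Iio_succ_eq_insert, Set.inter_insert_of_notMem hj]

theorem inter_Iio_succ_of_mem (hj : j ∈ K) : K ∩ Set.Iio (j + 1) = insert j (K ∩ Set.Iio j) := by
  rw [← Order.succ_eq_add_one, Order.Iio_succ_eq_insert, Set.inter_insert_of_mem hj]

theorem yields_fillBody (hb : 2 ≤ b) (hW : n < W) (hj : j < n) :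
    Yields W (fillBody b) (Filled b n i F δ K j) (Filled b n i F δ K (j + 1)) := by
  rintro s ⟨⟨hF, hm⟩, hc, h0, h1⟩
  have e0 : s.arr (Arr.next 0) = δ 0 := hF.next 0 (by omega)
  have e1 : s.arr (Arr.next 1) = δ 1 := hF.next 1 (by omega)
  have : b ≠ 0 := by omega
  have : b ≠ 1 := by omega
  simp only [fillBody, wp_block_cons, wp_block_nil, Prog.wp, Test.Holds, wp_lookup, wp_tabulate]
  refine ⟨fun h => ?_, fun h => ?_⟩
  · replace h : j ∉ K := by simpa [hc, hF.zero, ← hm j hj] using h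
    refine ⟨?_, ⟨?_, ?_⟩, ?_, ?_, ?_⟩
    · simp [hc, hF.one]
      omega
    · simpa
    · simpa
    · simp [hc, hF.one]
    · simpa [inter_Iio_succ_of_notMem h]
    · simpa [inter_Iio_succ_of_notMem h]
  · replace h : j ∈ K := by simpa [hc, hF.zero, ← hm j hj] using h
    refine ⟨?_, ⟨?_, ?_⟩, ?_, ?_, ?_⟩
    · simp [hc, hF.one]
      omega
    · simpa
    · simpa
    · simp [hc, hF.one]
    · simpa [inter_Iio_succ_of_mem h, hc, ← e0] using h0.insert j
    · simpa [inter_Iio_succ_of_mem h, hc, ← e1] using h1.insert j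

theorem runs_fillPhase (hb : 2 ≤ b) (hW : n < W) (hn : 0 < n) :
    Runs W n (fillPhase b) (Marked b n i F δ K) (Filled b n i F δ K n) := by
  refine Runs.seq (J := Filled b n i F δ K 0) (Yields.runs ?_ hn)
    (Yields.runs_for hn (fun j hj => yields_fillBody hb hW hj) (fun _ _ h => h.cursor)
      fun _ _ h => h.marked.frame.size)
  intro s hs
  refine ⟨⟨?_, ?_⟩, ?_, ?_, ?_⟩
  · simpa using hs.frame
  · simpa using hs.degree_ne_zero
  · simp [hs.frame.zero]
  · simpa using tabulates_empty
  · simpa using tabulates_empty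

end Fill

section Check

variable {b n i W j : ℕ} {F : ℕ → ℕ} {δ : ℕ → ℕ → ℕ} {R : ℕ → ℕ → ℕ} {p p' : Prop} {s : State}

/-- Lower the flag unless the lookups in `l` and in `l'` give the same result. -/
def checkEq (l l' : List ℕ) : Prog :=
  block [lookup Reg.target l, lookup Reg.value l',
    .ite (.eq Reg.target Reg.value) .skip (.copy Reg.flag Reg.zero)]

/-- Lower the flag unless the two lookups of each pair in `L` give the same result. -/
def checkAll (L : List (List ℕ × List ℕ)) : Prog := block (L.map fun e => checkEq e.1 e.2)

/-- The equations that a marked state `q` has to satisfy: with `r` for the entry of the second table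
at `q · 1`, they are the injectivity of 0 and of 1, the carry at the digit `b - 1`, and that at the
other digits. -/
def markedEqs (b : ℕ) : List (List ℕ × List ℕ) :=
  ([Arr.predZero b, Arr.next 0], []) ::
    ([Arr.predOne b, Arr.next 1, Arr.next 1], [Arr.next 1]) ::
    ([Arr.next 0, Arr.next (b - 1), Arr.predZero b, Arr.next 1], [Arr.next 1, Arr.next 0]) ::
    (List.range (b - 1)).map fun a =>
      ([Arr.next (a + 1)], [Arr.next a, Arr.predZero b, Arr.next 1])

/-- The conditions on the state `k` that the program checks. -/
def Passes (b : ℕ) (R : ℕ → ℕ → ℕ) (k : ℕ) : Prop :=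
  R Arr.final (R (Arr.next 0) k) = R Arr.final k ∧
    (R (Arr.degree b) k ≠ 0 → ∀ e ∈ markedEqs b, e.1.foldr R k = e.2.foldr R k)

/-- Check the equations in `markedEqs b` if the state under the cursor is marked. -/
def checkMarked (b : ℕ) : Prog :=
  block [lookup Reg.value [Arr.degree b],
    .ite (.eq Reg.value Reg.zero) .skip (checkAll (markedEqs b))]

/-- Check the conditions on the state under the cursor. -/
def checkBody (b : ℕ) : Prog :=
  .seq (checkEq [Arr.final, Arr.next 0] [Arr.final])
    (.seq (checkMarked b) (.add Reg.cursor Reg.cursor Reg.one))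

/-- Check the conditions on all states. -/
def checkPhase (b : ℕ) : Prog :=
  .seq (block [.copy Reg.cursor Reg.zero, .copy Reg.flag Reg.one])
    (.while (.lt Reg.cursor Reg.size) (checkBody b))

/-- The cursor is at `j`, the arrays are `R`, and the flag is raised if and only if `p` holds. -/
structure Checking (b n i : ℕ) (F : ℕ → ℕ) (δ R : ℕ → ℕ → ℕ) (j : ℕ) (p : Prop) (s : State) :
    Prop where
  frame : Frame b n i F δ s
  arr : s.arr = R
  cursor : s.reg Reg.cursor = j
  flag : (p → s.reg Reg.flag = 1) ∧ (¬ p → s.reg Reg.flag = 0)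

theorem Checking.congr (h : Checking b n i F δ R j p s) (hp : p ↔ p') :
    Checking b n i F δ R j p' s :=
  propext hp ▸ h

theorem yields_checkEq (l l' : List ℕ) : Yields W (checkEq l l') (Checking b n i F δ R j p)
    (Checking b n i F δ R j (p ∧ l.foldr R j = l'.foldr R j)) := by
  rintro s ⟨hF, hR, hj, hp⟩
  simp only [checkEq, wp_block_cons, wp_block_nil, Prog.wp, Test.Holds, wp_lookup]
  refine ⟨fun h => ⟨by simpa, by simpa, by simpa, ?_⟩, fun h => ⟨by simpa, by simpa, by simpa, ?_⟩⟩
  · replace h : l.foldr R j = l'.foldr R j := by simpa [hR, hj] using h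
    simpa [h] using hp
  · replace h : l.foldr R j ≠ l'.foldr R j := by simpa [hR, hj] using h
    simp [h, hF.zero]

theorem yields_checkAll (L : List (List ℕ × List ℕ)) :
    Yields W (checkAll L) (Checking b n i F δ R j p)
      (Checking b n i F δ R j (p ∧ ∀ e ∈ L, e.1.foldr R j = e.2.foldr R j)) := by
  induction L generalizing p with
  | nil => exact fun s hs => hs.congr (by simp)
  | cons e L ih =>
    exact fun s hs => ((yields_checkEq e.1 e.2).seq ih s hs).mono fun s' h =>
      h.congr (by rw [List.forall_mem_cons, and_assoc])

theorem yields_checkMarked :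
    Yields W (checkMarked b) (Checking b n i F δ R j p) (Checking b n i F δ R j
      (p ∧ (R (Arr.degree b) j ≠ 0 → ∀ e ∈ markedEqs b, e.1.foldr R j = e.2.foldr R j))) := by
  rintro s ⟨hF, hR, hj, hp⟩
  simp only [checkMarked, wp_block_cons, wp_block_nil, Prog.wp, Test.Holds, wp_lookup]
  have hs : Checking b n i F δ R j p (s.setReg Reg.value
      ([Arr.degree b].foldr s.arr (s.reg Reg.cursor))) := ⟨by simpa, by simpa, by simpa, by simpa⟩
  refine ⟨fun h => hs.congr ?_, fun h => (yields_checkAll _ _ hs).mono fun s' h' => h'.congr ?_⟩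
  · replace h : R (Arr.degree b) j = 0 := by simpa [hR, hj, hF.zero] using h
    simp only [h, ne_eq, not_true_eq_false, false_imp_iff, and_true]
  · replace h : R (Arr.degree b) j ≠ 0 := by simpa [hR, hj, hF.zero] using h
    simp only [h, ne_eq, not_false_eq_true, true_imp_iff]

theorem yields_checkBody (hW : n < W) (hj : j < n) :
    Yields W (checkBody b) (Checking b n i F δ R j p)
      (Checking b n i F δ R (j + 1) (p ∧ Passes b R j)) := by
  refine (yields_checkEq _ _).seq (yields_checkMarked.seq ?_)
  rintro s ⟨hF, hR, hc, hp⟩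
  refine ⟨by rw [hc, hF.one]; omega, by simpa, hR, by simp [hc, hF.one], ?_⟩
  rw [and_assoc] at hp
  simpa [Passes] using hp

theorem runs_checkPhase (hW : n < W) (hn : 0 < n) :
    Runs W n (checkPhase b) (fun s => Frame b n i F δ s ∧ s.arr = R)
      (fun s => Checking b n i F δ R n (∀ k < n, Passes b R k) s) := by
  refine Runs.seq (J := Checking b n i F δ R 0 (∀ k < 0, Passes b R k)) (Yields.runs ?_ hn)
    (Yields.runs_for (I := fun j => Checking b n i F δ R j (∀ k < j, Passes b R k)) hn
      (fun j hj s hs => (yields_checkBody hW hj s hs).mono fun s' h => h.congr ?_)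
      (fun _ _ h => h.cursor) fun _ _ h => h.frame.size)
  · rintro s ⟨hF, hR⟩
    exact ⟨by simpa, hR, by simp [hF.zero], by simp [hF.one]⟩
  · exact Nat.forall_lt_succ_right.symm

section Tables

variable {K : Set ℕ} {T₀ T₁ : ℕ → ℕ}

theorem carryLaws_iff_of_tabulates (hK : K.Finite) (h0 : Set.MapsTo (δ 0) K K)
    (h1 : Set.MapsTo (δ 1) K K) (hT₀ : Tabulates T₀ (δ 0) id K)
    (hT₁ : Tabulates T₁ (δ 1 ∘ δ 1) (δ 1) K) :
    CarryLaws b δ K ↔ ∀ q ∈ K, T₀ (δ 0 q) = q ∧ T₁ (δ 1 (δ 1 q)) = δ 1 q ∧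
      δ 0 (δ (b - 1) (T₀ (δ 1 q))) = δ 1 (δ 0 q) ∧
      ∀ a < b - 1, δ (a + 1) q = δ a (T₀ (δ 1 q)) := by
  have inj₀ : Set.InjOn (δ 0) K ↔ ∀ q ∈ K, T₀ (δ 0 q) = q := hT₀.forall_eq_iff.symm
  have inj₁ : Set.InjOn (δ 1) (δ 1 '' K) ↔ ∀ q ∈ K, T₁ (δ 1 (δ 1 q)) = δ 1 q := by
    simpa only [Set.InjOn, Set.forall_mem_image, Function.comp_apply] using hT₁.forall_eq_iff.symm
  have pred (hi : Set.InjOn (δ 0) K) : ∀ q ∈ K, T₀ (δ 1 q) ∈ K ∧ δ 0 (T₀ (δ 1 q)) = δ 1 q := by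
    intro q hq
    obtain ⟨r, hr, e⟩ := ((hK.injOn_iff_bijOn_of_mapsTo h0).1 hi).surjOn (h1 hq)
    rw [← e, inj₀.1 hi r hr]
    exact ⟨hr, rfl⟩
  constructor
  · rintro ⟨hi₀, hi₁, hsucc, hcarry⟩ q hq
    obtain ⟨hr, e⟩ := pred hi₀ q hq
    exact ⟨inj₀.1 hi₀ q hq, inj₁.1 hi₁ q hq, hcarry q hq _ hr e,
      fun a ha => hsucc q hq _ hr e a (by omega)⟩
  · intro h
    have eq_pred {q r : ℕ} (hr : r ∈ K) (e : δ 0 r = δ 1 q) : T₀ (δ 1 q) = r := by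
      rw [← e, (h r hr).1]
    refine ⟨inj₀.2 fun q hq => (h q hq).1, inj₁.2 fun q hq => (h q hq).2.1,
      fun q hq r hr e a ha => ?_, fun q hq r hr e => ?_⟩
    · rw [← eq_pred hr e]
      exact (h q hq).2.2.2 a (by omega)
    · rw [← eq_pred hr e]
      exact (h q hq).2.2.1

theorem Filled.forall_passes_iff (hb : 2 ≤ b) (hKn : K ⊆ Set.Iio n)
    (hK : ∀ a < b, Set.MapsTo (δ a) K K) (hs : Filled b n i F δ K n s) :
    (∀ k < n, Passes b s.arr k) ↔ (∀ q < n, F (δ 0 q) = F q) ∧ CarryLaws b δ K := by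
  obtain ⟨⟨hF, hm⟩, -, h₀, h₁⟩ := hs
  rw [Set.inter_eq_left.2 hKn] at h₀ h₁
  have e : ∀ a < b, s.arr (a + 1) = δ a := hF.next
  have hlast : s.arr (b - 1 + 1) = δ (b - 1) := e _ (by omega)
  have heqs : ∀ k, (∀ e ∈ markedEqs b, e.1.foldr s.arr k = e.2.foldr s.arr k) ↔
      s.arr (Arr.predZero b) (δ 0 k) = k ∧ s.arr (Arr.predOne b) (δ 1 (δ 1 k)) = δ 1 k ∧
      δ 0 (δ (b - 1) (s.arr (Arr.predZero b) (δ 1 k))) = δ 1 (δ 0 k) ∧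
      ∀ a < b - 1, δ (a + 1) k = δ a (s.arr (Arr.predZero b) (δ 1 k)) := by
    intro k
    simp only [markedEqs, List.forall_mem_cons, List.forall_mem_map, List.foldr_cons,
      List.foldr_nil, List.mem_range, Arr.next, e 0 (by omega), e 1 (by omega), hlast]
    refine and_congr_right' (and_congr_right' (and_congr_right' (forall₂_congr fun a ha => ?_)))
    rw [e (a + 1) (by omega), e a (by omega)]
  rw [carryLaws_iff_of_tabulates (b := b) ((Set.finite_Iio n).subset hKn) (hK 0 (by omega))
    (hK 1 (by omega)) h₀ h₁]
  simp only [Passes, heqs, hF.final, Arr.next, e 0 (by omega)]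
  rw [forall₂_and]
  refine and_congr_right' ⟨fun h q hq => h q (hKn hq) ((hm q (hKn hq)).2 hq),
    fun h k hk hd => h k ((hm k hk).1 hd)⟩

end Tables

end Check

section Transfer

variable {b : ℕ} {σ τ : Type*} {δ : ℕ → σ → σ} {δ' : ℕ → τ → τ} {e : σ → τ} {K : Set σ}

theorem carryLaws_image_iff (hb : 2 ≤ b) (he : Function.Injective e)
    (h : ∀ a < b, ∀ q, δ' a (e q) = e (δ a q)) :
    CarryLaws b δ' (e '' K) ↔ CarryLaws b δ K := by
  have h0 := h 0 (by omega)
  have h1 := h 1 (by omega)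
  have hlast := h (b - 1) (by omega)
  have hlt : ∀ a, a + 1 < b → ∀ q, δ' a (e q) = e (δ a q) := fun a ha => h a (by omega)
  constructor
  all_goals
    rintro ⟨g1, g2, g3, g4⟩
    simp +contextual only [Set.InjOn, Set.forall_mem_image, h0, h1, hlast, h, hlt, he.eq_iff]
      at g1 g2 g3 g4
    constructor <;>
      simpa +contextual only [Set.InjOn, Set.forall_mem_image, h0, h1, hlast, h, hlt, he.eq_iff]

end Transfer

section Input

variable {b n W : ℕ} {A : DFA (Fin b) (Fin n)}

theorem input_next {a : ℕ} (ha : a < b) (q : Fin n) :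
    (input A).arr (Arr.next a) q = stepNat A a q := by
  simp [input, stepNat, ha]

theorem input_final_eq_iff (q r : Fin n) :
    (input A).arr Arr.final q = (input A).arr Arr.final r ↔ (q ∈ A.accept ↔ r ∈ A.accept) := by
  by_cases hq : q ∈ A.accept <;> by_cases hr : r ∈ A.accept <;> simp [input, hq, hr]

theorem input_next_lt : ∀ a < b, ∀ q < n, (input A).arr (Arr.next a) q < n :=
  fun _ ha q hq => (input_next ha ⟨q, hq⟩).trans_lt (Fin.is_lt _)

theorem isGreatest_core_image :
    IsGreatest {S | PredClosedBelow (fun a => (input A).arr (Arr.next a)) n b S}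
      (Fin.val '' core A) := by
  refine ⟨?_, fun S hS r hr => ⟨⟨r, (hS r hr).1⟩, ?_, rfl⟩⟩
  · rintro _ ⟨r, hr, rfl⟩
    obtain ⟨q, hq, a, rfl⟩ := isPredClosed_core r hr
    refine ⟨Fin.is_lt _, q, ⟨q, hq, rfl⟩, a, a.2, ?_⟩
    exact (input_next a.2 q).trans (congrArg Fin.val (step_eq_stepNat q a).symm)
  · refine IsPredClosed.subset_core (S := {q : Fin n | (q : ℕ) ∈ S}) (fun q hq => ?_) hr
    obtain ⟨-, p, hp, a, ha, e⟩ := hS q hq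
    refine ⟨⟨p, (hS p hp).1⟩, hp, ⟨a, ha⟩, Fin.ext ?_⟩
    rw [← e, step_eq_stepNat]
    exact (input_next ha _).symm

theorem IsMinimal.inCount_ne_zero (hA : IsMinimal A) {r : ℕ} (hr : r < n) (hne : r ≠ A.start) :
    inCount (fun a => (input A).arr (Arr.next a)) (Finset.range n ×ˢ Finset.range b) r ≠ 0 := by
  obtain ⟨w, hw⟩ := hA.1 ⟨r, hr⟩
  obtain rfl | ⟨v, a, rfl⟩ := w.eq_nil_or_concat'
  · exact absurd (congrArg Fin.val hw).symm hne
  · refine UPC.inCount_ne_zero.2 ⟨A.eval v, a, by simp, ?_⟩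
    rw [input_next a.2, ← step_eq_stepNat, ← DFA.eval_append_singleton, hw]

theorem upCriterion_iff_input (hb : 2 ≤ b) (hA : IsMinimal A) :
    UPCriterion A ↔
      (∀ q < n, (input A).arr Arr.final ((input A).arr (Arr.next 0) q) =
        (input A).arr Arr.final q) ∧
      CarryLaws b (fun a => (input A).arr (Arr.next a)) (Fin.val '' core A) := by
  rw [upCriterion_iff_carryLaws hb hA.2,
    carryLaws_image_iff hb Fin.val_injective fun a ha q => input_next ha q]
  refine and_congr_left' ⟨fun h q hq => ?_, fun h q => ?_⟩
  · rw [input_next (by omega) ⟨q, hq⟩]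
    exact (input_final_eq_iff _ _).2 (h ⟨q, hq⟩)
  · rw [← input_final_eq_iff, ← input_next (by omega)]
    exact h q q.2

/-- The decision procedure: delete the states without predecessors repeatedly, invert the actions
of 0 and 1 on the remaining states by tables, and check the conditions on each state. -/
def decideUP (b : ℕ) : Prog :=
  .seq (countPhase b) (.seq (peelPhase b) (.seq (fillPhase b)
    (.seq (checkPhase b) (.copy Reg.size Reg.flag))))

theorem runs_decideUP (hb : 2 ≤ b) (hA : IsMinimal A) (hW : n * b + n < W) :
    Runs W n (decideUP b) (· = input A)
      (fun s => (UPCriterion A → s.reg 0 = 1) ∧ (¬ UPCriterion A → s.reg 0 = 0)) := by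
  have hn : 0 < n := A.start.pos
  have hnW : n < W := by omega
  have hcore : ∀ a < b, Set.MapsTo ((input A).arr (Arr.next a)) (Fin.val '' core A)
      (Fin.val '' core A) := by
    rintro a ha _ ⟨q, hq, rfl⟩
    exact ⟨_, stepNat_mem_core hq a, (input_next ha q).symm⟩
  refine (runs_countPhase hW hn).seq ((runs_peelPhase hW isGreatest_core_image input_next_lt
    A.start.2 fun r hr hne => hA.inCount_ne_zero hr hne).seq ((runs_fillPhase hb hnW hn).seq ?_))
  intro s hs
  refine ((runs_checkPhase hnW hn).seq (Yields.runs ?_ hn)) s ⟨hs.marked.frame, rfl⟩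
  intro s' hs'
  have hiff := (hs.forall_passes_iff hb (isGreatest_core_image.1 · · |>.1) hcore).trans
    (upCriterion_iff_input hb hA).symm
  simpa [Prog.wp] using (hs'.congr hiff).flag

end Input

end UPC

theorem theoremt (b : ℕ) (hb : 2 ≤ b) :
    UPC.LinearTimeOnMinimal b (fun {_n} A => UPC.UPCriterion A) := by
  refine ⟨UPC.decideUP b, (UPC.decideUP b).size + b + 2, fun n A hA => ?_⟩
  have hn : 0 < n := A.start.pos
  have hW : n * b + n < ((UPC.decideUP b).size + b + 2) * n := by
    calc n * b + n < (b + 2) * n := by linarith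
      _ ≤ ((UPC.decideUP b).size + b + 2) * n := Nat.mul_le_mul_right n (by omega)
  obtain ⟨t, s, hexec, ht, hs⟩ := UPC.runs_decideUP hb hA hW _ rfl
  exact ⟨t, s, hexec, ht.trans (Nat.mul_le_mul_right n (by omega)), hs⟩
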